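/- **Setting.** Let $\mathcal G$ be either the two-dimensional torus $\mathbb Z^2/(n\mathbb Z)^2$ for some fixed $n\ge 1$, or the square lattice $\mathbb Z^2$ ("$n=\infty$"). Its directed edges are the pairs $\vec e=(k,v)$ with $k$ a vertex and $v\in\{\pm e_1,\pm e_2\}$; $(k,v)$ leads from $k$ to $k+v$, its reversal is $-\vec e=(k+v,-v)$, and an (undirected) edge is a pair $e=\{\vec e,-\vec e\}$. (For $n=1,2$ this graph has self-loops, respectively parallel edges.) Every edge has the same weight $x>0$. A *rooted loop* of length $m\ge 1$ is a sequence of directed edges $(\omega_1,\dots,\omega_m,\omega_{m+1}=\omega_1)$ such that, for $1\le i\le m$, $\omega_{i+1}$ starts where $\omega_i$ ends and $\omega_{i+1}\neq-\omega_i$. A *loop* $\ell$ is an equivalence class of rooted loops under cyclic shifts and reversal; its multiplicity $m_\ell$ is the largest $r$ such that $\ell$ is the $r$-fold concatenation of a rooted loop with itself, and $N_\ell(e)$ is its number of visits to the edge $e$, in either direction. The *non-backtracking loop soup* $\mathcal L$ with parameter $x$ is the Poisson point process on the set of loops with intensity $\mu(\ell)=x^{|\ell|}/m_\ell$, where $|\ell|$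 is the length of $\ell$; i.e. the numbers of occurrences $\#\ell$ of the loops in $\mathcal L$ are independent Poisson variables with means $\mu(\ell)$. Let $N_{\mathcal L}(e)=\sum_\ell \#\ell\cdot N_\ell(e)$ be the total number of visits of the loops of $\mathcal L$ to $e$, and $\langle N_{\mathcal L}(e)\rangle$ its expectation. **Theorem.** For every edge $e$ of $\mathcal G$, one has $0<\langle N_{\mathcal L}(e)\rangle<\infty$ for all $0<x<1/3$, and, as $x\nearrow 1/3$, $$\frac{N_{\mathcal L}(e)}{\langle N_{\mathcal L}(e)\rangle}\ \longrightarrow\ Z^2\quad\text{in distribution},$$ where $Z$ is a standard normal random variable. -/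

import Mathlib

open MeasureTheory ProbabilityTheory Filter Topology
open scoped NNReal ENNReal

/-- An undirected graph (loops and multiple edges allowed) presented by its directed edges:
every `e : D` has a tail, a head and a reversal, and reversal is a fixed-point-free involution
which exchanges tail and head. -/
structure SerreGraph (V D : Type*) where
  tail : D → V
  head : D → V
  rev : D → D
  rev_rev : ∀ e, rev (rev e) = e
  rev_ne : ∀ e, rev e ≠ e
  tail_rev : ∀ e, tail (rev e) = head e

namespace SerreGraph

variable {V D : Type*} (G : SerreGraph V D)

/-- Two directed edges are identified if they agree up to reversal. -/
def edgeSetoid : Setoid D where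
  r a b := a = b ∨ a = G.rev b
  iseqv :=
    { refl := fun _ => Or.inl rfl
      symm := by
        rintro a b (rfl | rfl)
        · exact Or.inl rfl
        · exact Or.inr (G.rev_rev b).symm
      trans := by
        rintro a b c (rfl | rfl) (rfl | rfl)
        · exact Or.inl rfl
        · exact Or.inr rfl
        · exact Or.inr rfl
        · exact Or.inl (G.rev_rev c) }

/-- Undirected edges. -/
def Edge : Type _ := Quotient G.edgeSetoid

/-- The undirected version of a directed edge. -/
def toEdge (a : D) : G.Edge := Quotient.mk G.edgeSetoid a

theorem toEdge_rev (a : D) : G.toEdge (G.rev a) = G.toEdge a :=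
  Quotient.sound (s := G.edgeSetoid) (Or.inr rfl)

/-- A non-backtracking step from the directed edge `a` to the directed edge `b`. -/
def Step (a b : D) : Prop := G.tail b = G.head a ∧ b ≠ G.rev a

theorem step_rev {a b : D} (h : G.Step a b) : G.Step (G.rev b) (G.rev a) := by
  refine ⟨?_, ?_⟩
  · rw [G.tail_rev, ← G.tail_rev (G.rev b), G.rev_rev, h.1]
  · rw [G.rev_rev]
    exact fun hab => h.2 hab.symm

/-- A rooted non-backtracking loop `(ω₁, …, ωₙ, ωₙ₊₁)` with `n ≥ 1` and `ωₙ₊₁ = ω₁`, stored as the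
list `[ω₁, …, ωₙ]`. The field `chain` says that `ωᵢ → ωᵢ₊₁` is a non-backtracking step for every
`1 ≤ i ≤ n`, including the closing step `ωₙ → ω₁`. -/
structure RootedLoop where
  edges : List D
  ne_nil : edges ≠ []
  chain : (edges : Cycle D).Chain G.Step

/-- The list of directed edges of the reversed walk. -/
def revList (l : List D) : List D := (l.map G.rev).reverse

theorem revList_revList (l : List D) : G.revList (G.revList l) = l := by
  have h : G.rev ∘ G.rev = id := funext G.rev_rev
  simp [revList, h]

theorem revList_isRotated {l l' : List D} (h : l ~r l') : G.revList l ~r G.revList l' :=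
  (h.map G.rev).reverse

theorem chain_revList {l : List D} (h : (l : Cycle D).Chain G.Step) :
    (G.revList l : Cycle D).Chain G.Step := by
  rcases l with - | ⟨a, l⟩
  · exact h
  · have h1 : List.IsChain G.Step (a :: (l ++ [a])) := (Cycle.chain_coe_cons _ _ _).1 h
    have h2 : List.IsChain G.Step (G.revList (a :: (l ++ [a]))) := by
      rw [revList, List.isChain_reverse, List.isChain_map]
      exact h1.imp fun _ _ hs => G.step_rev hs
    have h3 : ((G.revList (a :: l) : List D) : Cycle D) = (G.rev a :: G.revList l : List D) := by
      rw [Cycle.coe_eq_coe]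
      simpa [revList] using List.isRotated_concat (G.rev a) (l.map G.rev).reverse
    rw [h3, Cycle.chain_coe_cons]
    simpa [revList] using h2

/-- Two rooted loops are equivalent if they agree up to a cyclic shift and, possibly, reversal. -/
def loopSetoid : Setoid G.RootedLoop where
  r a b := a.edges ~r b.edges ∨ a.edges ~r G.revList b.edges
  iseqv :=
    { refl := fun _ => Or.inl (List.IsRotated.refl _)
      symm := by
        rintro a b (h | h)
        · exact Or.inl h.symm
        · refine Or.inr ?_
          have := G.revList_isRotated h.symm
          rwa [revList_revList] at this
      trans := by
        rintro a b c (h | h) (h' | h')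
        · exact Or.inl (h.trans h')
        · exact Or.inr (h.trans h')
        · exact Or.inr (h.trans (G.revList_isRotated h'))
        · refine Or.inl (h.trans ?_)
          have := G.revList_isRotated h'
          rwa [revList_revList] at this }

/-- (Unrooted, unoriented) non-backtracking loops. -/
def Loop : Type _ := Quotient G.loopSetoid

/-- The multiplicity of a rooted loop: the largest `m` such that the loop is the `m`-fold
concatenation of some rooted loop with itself. -/
noncomputable def multiplicity (ω : G.RootedLoop) : ℕ :=
  sSup {m : ℕ | ∃ ω' : G.RootedLoop, ω.edges = (List.replicate m ω'.edges).flatten}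

/-- The weight `∏ᵢ √(x(ωᵢ) x(ωᵢ₊₁))` of a rooted loop, for given edge weights `x`. -/
noncomputable def weight (x : G.Edge → ℝ≥0) (ω : G.RootedLoop) : ℝ≥0 :=
  (List.zipWith (fun a b => NNReal.sqrt (x (G.toEdge a) * x (G.toEdge b)))
    ω.edges (ω.edges.rotate 1)).prod

open Classical in
/-- The number of visits of a rooted loop to an undirected edge (in either direction). -/
noncomputable def rootedVisits (e : G.Edge) (ω : G.RootedLoop) : ℕ :=
  ω.edges.countP (fun a => G.toEdge a = e)

theorem flatten_replicate_append {α : Type*} (a t : List α) (m : ℕ) :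
    a ++ (List.replicate m (t ++ a)).flatten = (List.replicate m (a ++ t)).flatten ++ a := by
  induction m with
  | zero => simp
  | succ m ih => simp only [List.replicate_succ, List.flatten_cons, List.append_assoc, ih]

theorem flatten_replicate_isRotated {α : Type*} {l l' w : List α} {m : ℕ}
    (h : l = (List.replicate m w).flatten) (hr : l ~r l') :
    ∃ w', w' ~r w ∧ l' = (List.replicate m w').flatten := by
  obtain ⟨n, rfl⟩ := hr
  subst h
  induction n with
  | zero => exact ⟨w, List.IsRotated.refl _, by simp⟩
  | succ n ih =>
    obtain ⟨w', hw', h'⟩ := ih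
    rw [← List.rotate_rotate, h']
    rcases w' with - | ⟨a, t⟩
    · exact ⟨[], hw', by simp⟩
    · refine ⟨t ++ [a], (List.isRotated_concat a t).trans hw', ?_⟩
      rcases m with - | m
      · simp
      · have := flatten_replicate_append [a] t m
        simp only [List.replicate_succ, List.flatten_cons, List.cons_append,
          List.rotate_cons_succ, List.rotate_zero, List.append_assoc]
        simpa using this.symm

theorem revList_flatten_replicate (w : List D) (m : ℕ) :
    G.revList (List.replicate m w).flatten = (List.replicate m (G.revList w)).flatten := by
  simp [revList, List.map_flatten, List.reverse_flatten]

theorem multiplicity_le {ω₁ ω₂ : G.RootedLoop} (h : G.loopSetoid ω₁ ω₂) (m : ℕ)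
    (hm : ∃ ω' : G.RootedLoop, ω₁.edges = (List.replicate m ω'.edges).flatten) :
    ∃ ω' : G.RootedLoop, ω₂.edges = (List.replicate m ω'.edges).flatten := by
  have key : ∀ (ω' : G.RootedLoop) (l : List D),
      (List.replicate m ω'.edges).flatten ~r l →
      ∃ ω'' : G.RootedLoop, l = (List.replicate m ω''.edges).flatten := by
    intro ω' l hl
    obtain ⟨w', hw', h'⟩ := flatten_replicate_isRotated rfl hl
    refine ⟨⟨w', ?_, ?_⟩, h'⟩
    · rintro rfl
      exact ω'.ne_nil (List.isRotated_nil_iff'.1 hw').symm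
    · rw [Cycle.coe_eq_coe.2 hw']
      exact ω'.chain
  obtain ⟨ω', h1⟩ := hm
  rcases h with h | h
  · exact key ω' _ (h1 ▸ h)
  · have h2 : (List.replicate m (G.revList ω'.edges)).flatten ~r ω₂.edges := by
      have := G.revList_isRotated h
      rwa [revList_revList, h1, revList_flatten_replicate] at this
    refine key ⟨G.revList ω'.edges, ?_, G.chain_revList ω'.chain⟩ _ h2
    simpa [revList] using ω'.ne_nil

theorem multiplicity_congr {ω₁ ω₂ : G.RootedLoop} (h : G.loopSetoid ω₁ ω₂) :
    G.multiplicity ω₁ = G.multiplicity ω₂ := by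
  unfold multiplicity
  congr 1
  ext m
  exact ⟨G.multiplicity_le h m, G.multiplicity_le (G.loopSetoid.symm h) m⟩

theorem prod_zipWith_sqrt {α : Type*} (f : α → ℝ≥0) (l l' : List α)
    (h : l.length = l'.length) :
    (List.zipWith (fun a b => NNReal.sqrt (f a * f b)) l l').prod =
      NNReal.sqrt ((l.map f).prod * (l'.map f).prod) := by
  induction l generalizing l' with
  | nil =>
    rcases l' with - | ⟨b, l'⟩
    · simp
    · simp at h
  | cons a l ih =>
    rcases l' with - | ⟨b, l'⟩
    · simp at h
    · simp only [List.zipWith_cons_cons, List.prod_cons, List.map_cons]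
      rw [ih l' (by simpa using h), ← NNReal.sqrt_mul]
      congr 1
      ring

theorem weight_eq (x : G.Edge → ℝ≥0) (ω : G.RootedLoop) :
    G.weight x ω = (ω.edges.map fun a => x (G.toEdge a)).prod := by
  have h : ((ω.edges.rotate 1).map fun a => x (G.toEdge a)).prod =
      (ω.edges.map fun a => x (G.toEdge a)).prod :=
    ((List.rotate_perm ω.edges 1).map _).prod_eq
  rw [weight, prod_zipWith_sqrt (fun a => x (G.toEdge a)) _ _ (by simp), h, NNReal.sqrt_mul_self]

theorem toEdge_comp_rev : G.toEdge ∘ G.rev = G.toEdge := funext G.toEdge_rev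

theorem map_toEdge_perm {ω₁ ω₂ : G.RootedLoop} (h : G.loopSetoid ω₁ ω₂) :
    (ω₁.edges.map G.toEdge).Perm (ω₂.edges.map G.toEdge) := by
  rcases h with h | h
  · exact h.perm.map _
  · refine (h.perm.map _).trans ?_
    rw [revList, ← List.map_reverse, List.map_map, toEdge_comp_rev]
    exact (List.reverse_perm _).map _

theorem weight_congr (x : G.Edge → ℝ≥0) {ω₁ ω₂ : G.RootedLoop} (h : G.loopSetoid ω₁ ω₂) :
    G.weight x ω₁ = G.weight x ω₂ := by
  have := ((G.map_toEdge_perm h).map x).prod_eq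
  rw [List.map_map, List.map_map] at this
  rw [weight_eq, weight_eq]
  exact this

open Classical in
theorem rootedVisits_congr (e : G.Edge) {ω₁ ω₂ : G.RootedLoop} (h : G.loopSetoid ω₁ ω₂) :
    G.rootedVisits e ω₁ = G.rootedVisits e ω₂ := by
  have := (G.map_toEdge_perm h).countP_eq (fun a => decide (a = e))
  rw [List.countP_map, List.countP_map] at this
  exact this

/-- The loop measure `μ(ℓ) = x(ℓ) / m_ℓ`. -/
noncomputable def loopMeasure (x : G.Edge → ℝ≥0) (ℓ : G.Loop) : ℝ≥0 :=
  Quotient.lift (s := G.loopSetoid) (fun ω => G.weight x ω / G.multiplicity ω)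
    (fun _ _ h => by rw [G.weight_congr x h, G.multiplicity_congr h]) ℓ

/-- The number of visits of a loop to an undirected edge. -/
noncomputable def visits (e : G.Edge) (ℓ : G.Loop) : ℕ :=
  Quotient.lift (s := G.loopSetoid) (G.rootedVisits e) (fun _ _ h => G.rootedVisits_congr e h) ℓ

/-- The law of the loop soup, i.e. of the Poisson point process with intensity measure `μ` on the
discrete space of loops. A realization is recorded by the numbers of occurrences `#ℓ` of the loops
`ℓ`, which are independent Poisson variables with means `μ(ℓ)`. -/
noncomputable def soupLaw (x : G.Edge → ℝ≥0) : Measure (G.Loop → ℕ) :=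
  Measure.infinitePi fun ℓ => poissonMeasure (G.loopMeasure x ℓ)

instance (x : G.Edge → ℝ≥0) : IsProbabilityMeasure (G.soupLaw x) := by
  unfold soupLaw
  infer_instance

/-- The edge-occupation number: the total number of visits of the loops of a configuration `L`
to the edge `e`. -/
noncomputable def occupation (e : G.Edge) (L : G.Loop → ℕ) : ℝ≥0∞ :=
  ∑' ℓ : G.Loop, (L ℓ : ℝ≥0∞) * (G.visits e ℓ : ℝ≥0∞)

/-- The expectation of the occupation number of `e` in the loop soup. -/
noncomputable def meanOccupation (x : G.Edge → ℝ≥0) (e : G.Edge) : ℝ≥0∞ :=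
  ∫⁻ L, G.occupation e L ∂(G.soupLaw x)

/-- The occupation number of `e` divided by its expectation. -/
noncomputable def normalizedOccupation (x : G.Edge → ℝ≥0) (e : G.Edge) (L : G.Loop → ℕ) : ℝ :=
  (G.occupation e L / G.meanOccupation x e).toReal

end SerreGraph

/-- The `d`-dimensional hypercubic graph with vertex set `R ^ d`: the lattice `ℤ ^ d` for `R = ℤ`,
the torus `(ℤ / nℤ) ^ d` for `R = ZMod n`. The directed edge `(k, j, ε)`, with `ε = ±1`, leads from
`k` to `k + ε eⱼ`, where `eⱼ` is the `j`-th standard unit vector; its reversal is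
`(k + ε eⱼ, j, -ε)`. -/
def hypercubicGraph (R : Type) [CommRing R] (d : ℕ) :
    SerreGraph (Fin d → R) ((Fin d → R) × Fin d × ℤˣ) where
  tail e := e.1
  head e := e.1 + Pi.single e.2.1 ((e.2.2 : ℤ) : R)
  rev e := (e.1 + Pi.single e.2.1 ((e.2.2 : ℤ) : R), e.2.1, -e.2.2)
  rev_rev := by
    rintro ⟨k, j, ε⟩
    simp [add_assoc, ← Pi.single_add]
  rev_ne := by
    rintro ⟨k, j, ε⟩ h
    simp only [Prod.mk.injEq] at h
    rcases Int.units_eq_one_or ε with rfl | rfl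
    · exact absurd h.2.2 (by decide)
    · exact absurd h.2.2 (by decide)
  tail_rev _ := rfl

/-! The occupation number is a sum of independent Poisson variables with coefficients $N_\ell$, so
with $z=e^{it}$ its characteristic function is $\exp\sum_\ell\mu(\ell)(z^{N_\ell}-1)$. The theorem
follows from a closed form for this exponent.

Rooting removes the multiplicity. A non-backtracking loop is never a cyclic shift of its reversal,
so exactly $2N_\ell/m_\ell$ rooted representatives start at $\pm\vec e$
(`multiplicity_mul_card_rootedAt`). Hence $2z$ times the $z$-derivative of the exponent is a sum
over closed walks from $\vec e$ and $-\vec e$ in which each visit to $e$ costs an extra factor $z$.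
Changing two weights is a rank-two perturbation of the Green function $G$
(`tsum_pathWeight_modified`). Reflection in the midpoint of $e$ swaps $\pm\vec e$, so the $2\times2$
problem has eigenvalues $A\pm B$, with $A=G(\vec e,\vec e)$ and $B=G(\vec e,-\vec e)$. Integrating
from $1$ to $z$ (`tsum_mul_pow_sub_one_eq_log`) turns the exponent into
$-\frac12\log(1-(z-1)g)-\frac12\log(1-(z-1)h)$ with $g=A+B-1$, $h=A-B-1$. The mean is $(g+h)/2=A-1$.

It remains to see that $A\to\infty$ and $B/A\to1$ as $x\nearrow1/3$. Then $g/(A-1)\to2$ and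
$h/(A-1)\to0$, and the characteristic function at $t=\theta/(A-1)$ tends to $(1-2i\theta)^{-1/2}$,
that of $Z^2$. Divergence is recurrence of the non-backtracking walk, proved on $\mathbb Z^2$ by a
second-moment bound and Cauchy–Schwarz (`pow_le_mul_walkCount_rev`) and projected to the torus. The
ratio follows from a maximum principle and the first-step equation (`tendsto_green_div_green`). -/

/-! ### Weighted sums of independent Poisson variables -/

theorem lintegral_natCast_poissonMeasure (r : ℝ≥0) :
    ∫⁻ n, (n : ℝ≥0∞) ∂(poissonMeasure r) = r := by
  rw [lintegral_countable']
  have h0 : ∀ n : ℕ, ENNReal.ofReal (Real.exp (-r) * r ^ n / n.factorial) =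
      poissonMeasure r {n} := fun n => (poissonMeasure_singleton r n).symm
  have h1 : ∀ n : ℕ, ((n + 1 : ℕ) : ℝ≥0∞) * poissonMeasure r {n + 1} = r * poissonMeasure r {n} := by
    intro n
    rw [← h0, ← h0, ← ENNReal.ofReal_natCast, ← ENNReal.ofReal_coe_nnreal,
      ← ENNReal.ofReal_mul (by positivity), ← ENNReal.ofReal_mul (by positivity)]
    congr 1
    rw [Nat.factorial_succ]
    push_cast
    field_simp
    ring
  rw [tsum_eq_zero_add' ENNReal.summable]
  simp only [h1, Nat.cast_zero, zero_mul, zero_add, ENNReal.tsum_mul_left]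
  have h2 : ∑' n : ℕ, poissonMeasure r {n} = 1 := by
    have := lintegral_countable' (μ := poissonMeasure r) (fun _ => (1 : ℝ≥0∞))
    simpa using this.symm
  rw [h2, mul_one]

theorem measurable_natCast_apply_mul {ι : Type*} (i : ι) (c : ℝ≥0∞) :
    Measurable fun L : ι → ℕ => (L i : ℝ≥0∞) * c :=
  ((Measurable.of_discrete (f := fun n : ℕ => (n : ℝ≥0∞))).comp (measurable_pi_apply i)).mul_const c

theorem integral_cexp_mul_poissonMeasure (r : ℝ≥0) (t : ℝ) :
    ∫ n : ℕ, Complex.exp (t * n * Complex.I) ∂(poissonMeasure r) =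
      Complex.exp (r * (Complex.exp (t * Complex.I) - 1)) := by
  rw [← charFun_map_cast_poissonMeasure, charFun_apply_real,
    integral_map .of_discrete (by fun_prop)]
  simp

section PoissonSum

variable {ι : Type*} (m : ι → ℝ≥0) (c : ι → ℕ)

theorem lintegral_tsum_infinitePi_poissonMeasure [Countable ι] :
    ∫⁻ L : ι → ℕ, ∑' i, (L i : ℝ≥0∞) * (c i : ℝ≥0∞)
      ∂(Measure.infinitePi fun i => poissonMeasure (m i)) = ∑' i, (m i : ℝ≥0∞) * (c i : ℝ≥0∞) := by
  rw [lintegral_tsum fun i => (measurable_natCast_apply_mul i _).aemeasurable]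
  congr 1
  funext i
  have hcast : Measurable fun n : ℕ => (n : ℝ≥0∞) := .of_discrete
  have hm : Measurable fun L : ι → ℕ => (L i : ℝ≥0∞) := hcast.comp (measurable_pi_apply i)
  rw [lintegral_mul_const _ hm]
  congr 1
  rw [← lintegral_natCast_poissonMeasure,
    ← Measure.infinitePi_map_eval (fun i => poissonMeasure (m i)) i,
    lintegral_map hcast (measurable_pi_apply i)]

theorem integral_cexp_finset_sum_infinitePi_poissonMeasure (t : ℝ) (s : Finset ι) :
    ∫ L : ι → ℕ, Complex.exp (t * ((∑ i ∈ s, (L i : ℝ) * c i : ℝ) : ℂ) * Complex.I)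
      ∂(Measure.infinitePi fun i => poissonMeasure (m i)) =
    Complex.exp (∑ i ∈ s, (m i : ℂ) * (Complex.exp (t * Complex.I) ^ c i - 1)) := by
  have h0 : ∀ L : ι → ℕ, Complex.exp (t * ((∑ i ∈ s, (L i : ℝ) * c i : ℝ) : ℂ) * Complex.I) =
      (fun y : s → ℕ => ∏ i : s, Complex.exp ((t * c i : ℝ) * (y i : ℂ) * Complex.I))
        (s.restrict L) := by
    intro L
    simp only [← Complex.exp_sum, Finset.restrict]
    rw [Finset.sum_coe_sort s fun i => (((t * c i : ℝ) : ℂ) * (L i : ℂ) * Complex.I)]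
    push_cast
    rw [Finset.mul_sum, Finset.sum_mul]
    congr 1
    exact Finset.sum_congr rfl fun i _ => by ring
  rw [integral_congr_ae (ae_of_all _ h0)]
  refine Eq.trans (integral_restrict_infinitePi (X := fun _ : ι => ℕ) (s := s)
    (fun i => poissonMeasure (m i))
    (f := fun y : s → ℕ => ∏ i : s, Complex.exp ((t * c i : ℝ) * (y i : ℂ) * Complex.I))
    (Measurable.aestronglyMeasurable (by fun_prop))) ?_
  rw [integral_fintype_prod_eq_prod
    (fun (i : s) (n : ℕ) => Complex.exp ((t * c i : ℝ) * (n : ℂ) * Complex.I))]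
  simp only [integral_cexp_mul_poissonMeasure]
  rw [← Complex.exp_sum, Finset.sum_coe_sort s fun i => ((m i : ℝ) : ℂ) *
    (Complex.exp (((t * c i : ℝ) : ℂ) * Complex.I) - 1)]
  congr 1
  refine Finset.sum_congr rfl fun i _ => ?_
  rw [← Complex.exp_nat_mul]
  push_cast
  congr 3
  ring

/-- Limit of the finite case: dominated convergence on the left, where integrands have modulus one,
and summability of the exponent on the right. Finiteness of the mean makes the sum almost surely
finite, so `toReal` discards nothing. -/
theorem integral_cexp_tsum_infinitePi_poissonMeasure [Countable ι] (t : ℝ)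
    (h : ∑' i, (m i : ℝ≥0∞) * (c i : ℝ≥0∞) ≠ ∞) :
    ∫ L : ι → ℕ, Complex.exp (t * ((∑' i, (L i : ℝ≥0∞) * (c i : ℝ≥0∞)).toReal : ℂ) * Complex.I)
      ∂(Measure.infinitePi fun i => poissonMeasure (m i)) =
    Complex.exp (∑' i, (m i : ℂ) * (Complex.exp (t * Complex.I) ^ c i - 1)) := by
  have hfin : ∀ᵐ L ∂(Measure.infinitePi fun i => poissonMeasure (m i)),
      ∑' i, (L i : ℝ≥0∞) * (c i : ℝ≥0∞) < ∞ := by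
    refine ae_lt_top (Measurable.tsum fun i => measurable_natCast_apply_mul i _) ?_
    rwa [lintegral_tsum_infinitePi_poissonMeasure]
  have hsum : Summable fun i => (m i : ℝ) * c i := by
    have h1 : Summable fun i => ((m i : ℝ≥0∞) * (c i : ℝ≥0∞)).toReal := ENNReal.summable_toReal h
    simpa using h1
  -- Dominated by the mean, since $|e^{ict}-1|\le c|t|$.
  have hsumC : Summable fun i => (m i : ℂ) * (Complex.exp (t * Complex.I) ^ c i - 1) := by
    refine Summable.of_norm_bounded (hsum.mul_left |t|) fun i => ?_
    rw [norm_mul, ← Complex.exp_nat_mul]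
    have h2 := Real.norm_exp_I_mul_ofReal_sub_one_le (x := c i * t)
    have h3 : Complex.exp ((c i : ℂ) * (t * Complex.I)) =
        Complex.exp (Complex.I * ((c i * t : ℝ) : ℂ)) := by
      push_cast
      congr 1
      ring
    rw [h3]
    calc ‖(m i : ℂ)‖ * _ ≤ (m i : ℝ) * ‖(c i * t : ℝ)‖ := by
          gcongr
          simp
      _ = |t| * (m i * c i) := by
          rw [norm_mul, Real.norm_eq_abs, Real.norm_eq_abs, Nat.abs_cast]
          ring
  have hlim1 : Tendsto (fun s : Finset ι => ∫ L : ι → ℕ,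
      Complex.exp (t * ((∑ i ∈ s, (L i : ℝ) * c i : ℝ) : ℂ) * Complex.I)
      ∂(Measure.infinitePi fun i => poissonMeasure (m i))) atTop
      (𝓝 (∫ L : ι → ℕ,
        Complex.exp (t * ((∑' i, (L i : ℝ≥0∞) * (c i : ℝ≥0∞)).toReal : ℂ) * Complex.I)
      ∂(Measure.infinitePi fun i => poissonMeasure (m i)))) := by
    refine tendsto_integral_filter_of_dominated_convergence (fun _ => (1 : ℝ)) ?_ ?_
      (integrable_const _) ?_
    · refine Eventually.of_forall fun s => Measurable.aestronglyMeasurable ?_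
      fun_prop
    · refine Eventually.of_forall fun s => Eventually.of_forall fun L => ?_
      rw [← Complex.ofReal_mul, Complex.norm_exp_ofReal_mul_I]
    · filter_upwards [hfin] with L hL
      have h1 : Summable fun i => (L i : ℝ) * c i := by
        have := ENNReal.summable_toReal hL.ne
        simpa using this
      have h2 : (∑' i, (L i : ℝ≥0∞) * (c i : ℝ≥0∞)).toReal = ∑' i, (L i : ℝ) * c i := by
        rw [ENNReal.tsum_toReal_eq fun i =>
          ENNReal.mul_ne_top (ENNReal.natCast_ne_top _) (ENNReal.natCast_ne_top _)]
        simp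
      rw [h2]
      have h3 := h1.hasSum
      have h4 : Continuous fun y : ℝ => Complex.exp (t * (y : ℂ) * Complex.I) := by fun_prop
      exact (h4.tendsto _).comp h3
  refine tendsto_nhds_unique hlim1 ?_
  simp only [integral_cexp_finset_sum_infinitePi_poissonMeasure]
  exact (Complex.continuous_exp.tendsto _).comp hsumC.hasSum

end PoissonSum

/-! ### Cyclic shifts of lists and their period -/

section Rotation

variable {α : Type*}

theorem List.iterate_rotate_one (l : List α) (i : ℕ) :
    (fun l : List α => l.rotate 1)^[i] l = l.rotate i := by
  induction i with
  | zero => simp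
  | succ i ih => rw [Function.iterate_succ_apply', ih, List.rotate_rotate]

theorem List.head?_rotate_lt {l : List α} {i : ℕ} (hi : i < l.length) :
    (l.rotate i).head? = some l[i] := by
  rw [List.rotate_eq_drop_append_take hi.le, List.head?_append_of_ne_nil, List.head?_drop,
    List.getElem?_eq_getElem hi]
  simpa using hi

/-- The least positive `d` such that the cyclic shift of `l` by `d` is `l`. -/
noncomputable def List.rotationPeriod (l : List α) : ℕ :=
  Function.minimalPeriod (fun l : List α => l.rotate 1) l

theorem List.rotate_eq_self_iff_rotationPeriod_dvd (l : List α) (i : ℕ) :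
    l.rotate i = l ↔ l.rotationPeriod ∣ i := by
  rw [List.rotationPeriod, ← Function.isPeriodicPt_iff_minimalPeriod_dvd, Function.IsPeriodicPt,
    Function.IsFixedPt, List.iterate_rotate_one]

theorem List.rotationPeriod_dvd_length (l : List α) : l.rotationPeriod ∣ l.length :=
  (l.rotate_eq_self_iff_rotationPeriod_dvd _).1 l.rotate_length

theorem List.rotationPeriod_pos {l : List α} (h : l ≠ []) : 0 < l.rotationPeriod :=
  Nat.pos_of_dvd_of_pos l.rotationPeriod_dvd_length (List.length_pos_iff.2 h)

theorem List.rotate_mod_rotationPeriod (l : List α) (i : ℕ) :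
    l.rotate (i % l.rotationPeriod) = l.rotate i := by
  rw [← List.iterate_rotate_one, ← List.iterate_rotate_one]
  exact Function.iterate_mod_minimalPeriod_eq

theorem List.rotate_injOn_rotationPeriod (l : List α) :
    Set.InjOn (fun i => l.rotate i) (Set.Iio l.rotationPeriod) := by
  have h := Function.iterate_injOn_Iio_minimalPeriod (f := fun l : List α => l.rotate 1) (x := l)
  intro i hi j hj hij
  refine h hi hj ?_
  simpa only [List.iterate_rotate_one] using hij

theorem List.rotate_flatten_replicate (w : List α) (m : ℕ) :
    (List.replicate m w).flatten.rotate w.length = (List.replicate m w).flatten := by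
  rcases m with - | m
  · simp
  · rw [List.replicate_succ, List.flatten_cons, List.rotate_append_length_eq]
    have := SerreGraph.flatten_replicate_append w [] m
    simpa using this.symm

/-- Cut $l=uv$ with $|u|=d$; invariance says $uv=vu$. If $|v|\ge d$, then $v$ begins with $u$ and is
again fixed by rotation by $d$, so induction applies to $v$. -/
theorem List.eq_flatten_replicate_of_rotate {l : List α} {d m : ℕ} (hl : l.length = m * d)
    (h : l.rotate d = l) : l = (List.replicate m (l.take d)).flatten := by
  induction m generalizing l with
  | zero => simpa using hl
  | succ m ih =>
    have hd : d ≤ l.length := by rw [hl]; nlinarith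
    rcases m with - | m
    · have : l.length ≤ d := by simp [hl]
      simp [List.take_of_length_le this]
    have h1 : l.drop d ++ l.take d = l.take d ++ l.drop d := by
      rw [List.take_append_drop, ← List.rotate_eq_drop_append_take hd, h]
    have h2 : (l.drop d).length = (m + 1) * d := by
      rw [List.length_drop, hl, Nat.succ_mul (m + 1), Nat.add_sub_cancel]
    have hd' : d ≤ (l.drop d).length := by rw [h2]; nlinarith
    have h3 : (l.drop d).take d = l.take d := by
      have := congrArg (List.take d) h1
      rwa [List.take_append_of_le_length hd', List.take_append_of_le_length (by simp [hd]),
        List.take_take, min_self] at this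
    have h4 : (l.drop d).rotate d = l.drop d := by
      rw [List.rotate_eq_drop_append_take hd', h3]
      have h5 := congrArg (List.drop d) h1
      rw [List.drop_append_of_le_length hd'] at h5
      rw [h5]
      simp
    have := ih h2 h4
    rw [h3] at this
    rw [List.replicate_succ, List.flatten_cons, ← this, List.take_append_drop]

open Classical in
/-- The set of cyclic shifts of a list. -/
noncomputable def List.rotations (l : List α) : Finset (List α) :=
  (Finset.range l.rotationPeriod).image fun i => l.rotate i

theorem List.mem_rotations {l l' : List α} (hl : l ≠ []) : l' ∈ l.rotations ↔ l' ~r l := by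
  classical
  rw [List.rotations, Finset.mem_image]
  constructor
  · rintro ⟨i, -, rfl⟩
    exact (List.IsRotated.forall l i)
  · intro h
    obtain ⟨i, rfl⟩ := h.symm
    exact ⟨i % l.rotationPeriod, Finset.mem_range.2 (Nat.mod_lt _ (List.rotationPeriod_pos hl)),
      l.rotate_mod_rotationPeriod i⟩

theorem List.sum_range_rotate (l : List α) (F : List α → ℕ) (m : ℕ) :
    ∑ i ∈ Finset.range (m * l.rotationPeriod), F (l.rotate i) =
      m * ∑ l' ∈ l.rotations, F l' := by
  classical
  have h1 : ∑ l' ∈ l.rotations, F l' = ∑ i ∈ Finset.range l.rotationPeriod, F (l.rotate i) := by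
    refine Finset.sum_image ?_
    intro i hi j hj
    exact l.rotate_injOn_rotationPeriod (by simpa using hi) (by simpa using hj)
  rw [h1]
  induction m with
  | zero => simp
  | succ m ih =>
    rw [Nat.succ_mul, Finset.sum_range_add, ih, Nat.succ_mul]
    congr 1
    refine Finset.sum_congr rfl fun i _ => ?_
    rw [← l.rotate_mod_rotationPeriod, add_comm, Nat.add_mul_mod_self_right, l.rotate_mod_rotationPeriod]

theorem List.sum_range_length_head?_rotate (l : List α) (p : α → Prop) [DecidablePred p] :
    ∑ i ∈ Finset.range l.length, (if ∃ a ∈ (l.rotate i).head?, p a then 1 else 0) =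
      l.countP p := by
  have h1 : ∀ i ∈ Finset.range l.length, (if ∃ a ∈ (l.rotate i).head?, p a then 1 else 0) =
      if ∃ a ∈ l[i]?, p a then 1 else 0 := by
    intro i hi
    rw [List.head?_rotate_lt (Finset.mem_range.1 hi), List.getElem?_eq_getElem]
  rw [Finset.sum_congr rfl h1]
  clear h1
  induction l with
  | nil => simp
  | cons a l ih =>
    rw [List.length_cons, Finset.sum_range_succ', List.countP_cons, ← ih]
    simp

end Rotation

/-! ### Multiplicity and rooted representatives of a loop -/

namespace SerreGraph

variable {V D : Type*} (G : SerreGraph V D)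

theorem isChain_left_of_flatten {w : List D} {m : ℕ} (hw : w ≠ []) (hm : 0 < m)
    (h : ((List.replicate m w).flatten : Cycle D).Chain G.Step) : (w : Cycle D).Chain G.Step := by
  obtain ⟨a, t, rfl⟩ := List.exists_cons_of_ne_nil hw
  obtain ⟨m, rfl⟩ : ∃ k, m = k + 1 := ⟨m - 1, by omega⟩
  rw [List.replicate_succ, List.flatten_cons, List.cons_append, Cycle.chain_coe_cons] at h
  rw [Cycle.chain_coe_cons]
  refine List.IsChain.prefix h ?_
  rcases m with - | m
  · simp
  · rw [List.replicate_succ, List.flatten_cons]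
    refine ⟨t ++ (List.replicate m (a :: t)).flatten ++ [a], ?_⟩
    simp

/-- A $k$-fold concatenation of $w$ is fixed by rotation by $|w|$, so the period divides $|w|$ and
$k$ is at most length over period. The initial block of one period attains this bound. -/
theorem multiplicity_mul_rotationPeriod (ω : G.RootedLoop) :
    G.multiplicity ω * ω.edges.rotationPeriod = ω.edges.length := by
  have hp := List.rotationPeriod_pos ω.ne_nil
  have hlen := List.length_pos_iff.2 ω.ne_nil
  obtain ⟨m, hm⟩ := ω.edges.rotationPeriod_dvd_length
  have hm' : ω.edges.length = m * ω.edges.rotationPeriod := by rw [hm, mul_comm]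
  have hm0 : 0 < m := by
    rcases Nat.eq_zero_or_pos m with rfl | h
    · omega
    · exact h
  have hrot : ω.edges.rotate ω.edges.rotationPeriod = ω.edges :=
    (ω.edges.rotate_eq_self_iff_rotationPeriod_dvd _).2 dvd_rfl
  have hg : IsGreatest {m : ℕ | ∃ ω' : G.RootedLoop,
      ω.edges = (List.replicate m ω'.edges).flatten} m := by
    have hfl := List.eq_flatten_replicate_of_rotate hm' hrot
    constructor
    · have hne : ω.edges.take ω.edges.rotationPeriod ≠ [] := by
        simp [hp.ne', ω.ne_nil]
      refine ⟨⟨_, hne, G.isChain_left_of_flatten hne hm0 ?_⟩, hfl⟩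
      rw [← hfl]
      exact ω.chain
    · rintro k ⟨ω', hk⟩
      have h1 : ω.edges.rotate ω'.edges.length = ω.edges := by
        rw [hk, List.rotate_flatten_replicate]
      have h2 := Nat.le_of_dvd (List.length_pos_iff.2 ω'.ne_nil)
        ((ω.edges.rotate_eq_self_iff_rotationPeriod_dvd _).1 h1)
      have h3 : ω.edges.length = k * ω'.edges.length := by
        conv_lhs => rw [hk]
        simp
      have h4 : k * ω.edges.rotationPeriod ≤ m * ω.edges.rotationPeriod := by
        rw [← hm', h3]
        exact Nat.mul_le_mul_left k h2
      exact Nat.le_of_mul_le_mul_right h4 hp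
  rw [multiplicity, hg.csSup_eq, hm']

theorem multiplicity_pos (ω : G.RootedLoop) : 0 < G.multiplicity ω := by
  have h := G.multiplicity_mul_rotationPeriod ω
  have := List.length_pos_iff.2 ω.ne_nil
  rcases Nat.eq_zero_or_pos (G.multiplicity ω) with h0 | h0
  · rw [h0, zero_mul] at h
    omega
  · exact h0

theorem length_revList (l : List D) : (G.revList l).length = l.length := by simp [revList]

theorem step_getElem (ω : G.RootedLoop) {i : ℕ} (hi : i + 1 < ω.edges.length) :
    G.Step ω.edges[i] ω.edges[i + 1] := by
  have h := ω.chain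
  obtain ⟨a, t, hat⟩ := List.exists_cons_of_ne_nil ω.ne_nil
  have h1 : List.IsChain G.Step ω.edges := by
    rw [hat, Cycle.chain_coe_cons] at h
    rw [hat]
    exact List.IsChain.prefix h ⟨[a], by simp⟩
  exact List.isChain_iff_getElem.1 h1 i hi

/-- A non-backtracking loop is not a cyclic shift of its reversal. -/
theorem not_isRotated_revList (ω : G.RootedLoop) : ¬ G.revList ω.edges ~r ω.edges := by
  intro h
  have hpos := List.length_pos_iff.2 ω.ne_nil
  obtain ⟨k, hk, hrot⟩ : ∃ k < ω.edges.length, ω.edges.rotate k = G.revList ω.edges := by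
    obtain ⟨k, hk⟩ := h.symm
    exact ⟨k % ω.edges.length, Nat.mod_lt _ hpos, by rw [List.rotate_mod, hk]⟩
  have key : ∀ i j (hij : i + j + 1 = ω.edges.length) (hik : i + k < ω.edges.length),
      G.rev (ω.edges[j]'(by omega)) = ω.edges[i + k] := by
    intro i j hij hik
    have h1 : (ω.edges.rotate k)[i]? = (G.revList ω.edges)[i]? := by rw [hrot]
    rw [List.getElem?_rotate (by omega), Nat.mod_eq_of_lt hik, List.getElem?_eq_getElem hik,
      List.getElem?_eq_getElem (by rw [length_revList]; omega)] at h1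
    rw [Option.some.injEq] at h1
    rw [h1]
    simp only [revList, List.getElem_reverse, List.getElem_map, List.length_map]
    congr 2
    omega
  -- The reversed indexing and the shift by `k` meet in the middle: in the even case at a single
  -- edge equal to its own reversal, in the odd case at two consecutive edges which are mutual
  -- reversals, i.e. a backtracking step.
  rcases Nat.even_or_odd' (ω.edges.length - 1 - k) with ⟨i, hi | hi⟩
  · exact G.rev_ne _ (key i (i + k) (by omega) (by omega))
  · have h1 := key i (i + k + 1) (by omega) (by omega)
    refine (G.step_getElem ω (i := i + k) (by omega)).2 ?_
    rw [← h1, G.rev_rev]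

/-- The reversal of a rooted loop. -/
def RootedLoop.reverse {G : SerreGraph V D} (ω : G.RootedLoop) : G.RootedLoop where
  edges := G.revList ω.edges
  ne_nil := by simpa [revList] using ω.ne_nil
  chain := G.chain_revList ω.chain

theorem reverse_equiv (ω : G.RootedLoop) : G.loopSetoid ω.reverse ω := Or.inr (List.IsRotated.refl _)

open Classical in
/-- The edge lists of the rooted loops which are equivalent to `ω`. -/
noncomputable def representatives (ω : G.RootedLoop) : Finset (List D) :=
  ω.edges.rotations ∪ ω.reverse.edges.rotations

theorem mem_representatives (ω ω' : G.RootedLoop) :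
    ω'.edges ∈ G.representatives ω ↔ G.loopSetoid ω' ω := by
  classical
  rw [representatives, Finset.mem_union, List.mem_rotations ω.ne_nil,
    List.mem_rotations ω.reverse.ne_nil]
  rfl

theorem exists_of_mem_representatives {ω : G.RootedLoop} {l : List D}
    (hl : l ∈ G.representatives ω) : ∃ ω' : G.RootedLoop, ω'.edges = l := by
  classical
  rw [representatives, Finset.mem_union, List.mem_rotations ω.ne_nil,
    List.mem_rotations ω.reverse.ne_nil] at hl
  have key : ∀ ω' : G.RootedLoop, l ~r ω'.edges → ∃ ω' : G.RootedLoop, ω'.edges = l := by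
    intro ω' h
    refine ⟨⟨l, ?_, ?_⟩, rfl⟩
    · rintro rfl
      exact ω'.ne_nil (List.isRotated_nil_iff'.1 h).symm
    · rw [Cycle.coe_eq_coe.2 h]
      exact ω'.chain
  rcases hl with hl | hl
  · exact key _ hl
  · exact key _ hl

/-- The loop is rooted at the edge `e`, in either direction. -/
def RootedAt (e : G.Edge) (l : List D) : Prop := ∃ a ∈ l.head?, G.toEdge a = e

open Classical in
-- Running through all positions of the loop meets each distinct cyclic shift `multiplicity` times,
-- and the positions at `e` are the visits. The shifts of the reversal contribute equally and are
-- disjoint from those of the loop, hence the factor 2.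
theorem multiplicity_mul_card_rootedAt (e : G.Edge) (ω : G.RootedLoop) :
    G.multiplicity ω * ((G.representatives ω).filter (G.RootedAt e)).card =
      2 * G.rootedVisits e ω := by
  have hdisj : Disjoint ω.edges.rotations ω.reverse.edges.rotations := by
    rw [Finset.disjoint_left]
    intro l h1 h2
    rw [List.mem_rotations ω.ne_nil] at h1
    rw [List.mem_rotations ω.reverse.ne_nil] at h2
    exact G.not_isRotated_revList ω (h2.symm.trans h1)
  have key : ∀ ω : G.RootedLoop, G.multiplicity ω *
      (∑ l ∈ ω.edges.rotations, if G.RootedAt e l then 1 else 0) = G.rootedVisits e ω := by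
    intro ω
    rw [← List.sum_range_rotate, G.multiplicity_mul_rotationPeriod]
    refine Eq.trans ?_ (ω.edges.sum_range_length_head?_rotate (fun a => G.toEdge a = e))
    exact Finset.sum_congr rfl fun i _ => if_congr Iff.rfl rfl rfl
  rw [Finset.card_filter, representatives, Finset.sum_union hdisj, mul_add, key,
    ← G.multiplicity_congr (G.reverse_equiv ω), key, G.rootedVisits_congr e (G.reverse_equiv ω),
    two_mul]

/-- The class of a rooted loop. -/
def toLoop (ω : G.RootedLoop) : G.Loop := Quotient.mk G.loopSetoid ω

theorem RootedLoop.edges_injective :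
    Function.Injective (RootedLoop.edges : G.RootedLoop → List D) := by
  rintro ⟨l, _, _⟩ ⟨l', _, _⟩ h
  simpa using h

instance [Countable D] : Countable G.RootedLoop := (RootedLoop.edges_injective G).countable

instance [Countable D] : Countable G.Loop := inferInstanceAs (Countable (Quotient G.loopSetoid))

open Classical in
theorem tsum_fiber_rootedAt {E : Type*} [AddCommMonoid E] [TopologicalSpace E] [T2Space E]
    (e : G.Edge) (ω : G.RootedLoop) (c : E) :
    ∑' ω' : G.toLoop ⁻¹' {G.toLoop ω}, (if G.RootedAt e ω'.1.edges then c else 0) =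
      ((G.representatives ω).filter (G.RootedAt e)).card • c := by
  let i : G.toLoop ⁻¹' {G.toLoop ω} → List D := fun ω' => ω'.1.edges
  have hi : Function.Injective i := (RootedLoop.edges_injective G).comp Subtype.val_injective
  have hmem : ∀ ω' : G.RootedLoop, ω'.edges ∈ G.representatives ω ↔
      ω' ∈ G.toLoop ⁻¹' {G.toLoop ω} := fun ω' => by
    rw [mem_representatives]
    exact (Quotient.eq (r := G.loopSetoid)).symm
  have h2 : ∑' ω' : G.toLoop ⁻¹' {G.toLoop ω}, (if G.RootedAt e ω'.1.edges then c else 0) =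
      ∑' l : List D, if l ∈ (G.representatives ω).filter (G.RootedAt e) then c else 0 := by
    rw [← hi.tsum_eq]
    · refine tsum_congr fun ω' => ?_
      have := (hmem ω'.1).2 ω'.2
      simp [i, this]
    · intro l hl
      have h3 : l ∈ (G.representatives ω).filter (G.RootedAt e) := by
        by_contra h
        exact hl (if_neg h)
      obtain ⟨ω', rfl⟩ := G.exists_of_mem_representatives (Finset.mem_filter.1 h3).1
      exact ⟨⟨ω', (hmem ω').1 (Finset.mem_filter.1 h3).1⟩, rfl⟩
  rw [h2, tsum_eq_sum (s := (G.representatives ω).filter (G.RootedAt e))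
    (fun l hl => if_neg hl), Finset.sum_congr rfl fun l hl => if_pos hl, Finset.sum_const]

/-- The number of directed edges of a loop. -/
noncomputable def rootedCount (e : G.Edge) (ℓ : G.Loop) : ℕ :=
  open Classical in ((G.representatives ℓ.out).filter (G.RootedAt e)).card

/-- The factor $1/m_\ell$ in the loop measure is absorbed: $2\mu(\ell)N_\ell(e)$ is the total weight
of the representatives rooted at $e$. -/
theorem rootedCount_mul_weight (x : G.Edge → ℝ≥0) (e : G.Edge) (ℓ : G.Loop) :
    (G.rootedCount e ℓ : ℝ≥0) * G.weight x ℓ.out = 2 * (G.loopMeasure x ℓ * G.visits e ℓ) := by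
  obtain ⟨ω, hω⟩ : ∃ ω, ω = ℓ.out := ⟨_, rfl⟩
  have h1 : G.loopMeasure x ℓ = G.weight x ω / G.multiplicity ω := by
    rw [← Quotient.out_eq ℓ, ← hω]
    rfl
  have h2 : G.visits e ℓ = G.rootedVisits e ω := by
    rw [← Quotient.out_eq ℓ, ← hω]
    rfl
  have h3 : (G.multiplicity ω : ℝ≥0) * G.rootedCount e ℓ = 2 * G.visits e ℓ := by
    rw [rootedCount, h2, ← hω]
    exact_mod_cast G.multiplicity_mul_card_rootedAt e ω
  have h4 : (G.multiplicity ω : ℝ≥0) ≠ 0 := by exact_mod_cast (G.multiplicity_pos ω).ne'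
  rw [h1, ← hω]
  field_simp
  rw [mul_comm, ← mul_assoc, h3]
  ring

theorem weight_out (x : G.Edge → ℝ≥0) (ω : G.RootedLoop) :
    G.weight x (Quotient.out (G.toLoop ω)) = G.weight x ω :=
  G.weight_congr x (Quotient.mk_out (s := G.loopSetoid) ω)

theorem toLoop_out (ℓ : G.Loop) : G.toLoop (Quotient.out ℓ) = ℓ := Quotient.out_eq ℓ

open Classical in
theorem tsum_rootedAt_fiberwise {E : Type*} [AddCommMonoid E] [TopologicalSpace E] [T3Space E]
    [ContinuousAdd E] (e : G.Edge) (F : G.Loop → E)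
    (hs : Summable fun ω : G.RootedLoop => if G.RootedAt e ω.edges then F (G.toLoop ω) else 0)
    (hs' : ∀ ℓ, Summable fun ω : G.toLoop ⁻¹' {ℓ} =>
      if G.RootedAt e ω.1.edges then F (G.toLoop ω.1) else 0) :
    HasSum (fun ℓ => G.rootedCount e ℓ • F ℓ)
      (∑' ω : G.RootedLoop, if G.RootedAt e ω.edges then F (G.toLoop ω) else 0) := by
  have h := ((Equiv.sigmaFiberEquiv G.toLoop).hasSum_iff.2 hs.hasSum).sigma fun ℓ => (hs' ℓ).hasSum
  convert h using 2 with ℓ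
  rw [rootedCount, ← tsum_fiber_rootedAt, toLoop_out]
  exact tsum_congr fun ω => by rw [show G.toLoop ω.1 = ℓ from ω.2]

end SerreGraph

/-! ### Weighted walks and the Green function -/

section PathWeight

variable {D : Type*} (S : D → Finset D)

/-- A list is either empty or has a head and a tail. -/
def listEquivSum (D : Type*) : List D ≃ Unit ⊕ D × List D where
  toFun
    | [] => .inl ()
    | a :: l => .inr (a, l)
  invFun
    | .inl _ => []
    | .inr p => p.1 :: p.2
  left_inv l := by cases l <;> rfl
  right_inv p := by rcases p with _ | ⟨a, l⟩ <;> rfl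

open Classical in
/-- The weight `t f * t l₁ * ⋯ * t lₙ` of the walk `f, l₁, …, lₙ, g` with respect to the successor
sets `S`; it is zero if `f, l₁, …, lₙ, g` is not a walk. -/
noncomputable def pathWeight {R : Type*} [CommSemiring R] (t : D → R) : D → List D → D → R
  | f, [], g => if g ∈ S f then t f else 0
  | f, h :: l, g => if h ∈ S f then t f * pathWeight t h l g else 0

theorem map_pathWeight {R R' : Type*} [CommSemiring R] [CommSemiring R'] (φ : R →+* R') (t : D → R)
    (f : D) (l : List D) (g : D) :
    φ (pathWeight S t f l g) = pathWeight S (fun a => φ (t a)) f l g := by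
  induction l generalizing f with
  | nil => rw [pathWeight, pathWeight]; split_ifs <;> simp
  | cons h l ih => rw [pathWeight, pathWeight]; split_ifs <;> simp [ih]

open Classical in
-- The endpoint `g` carries no weight. For `g = f` the list `f :: l` is therefore a rooted loop,
-- weighted by the product over its edges.
theorem pathWeight_eq_prod {R : Type*} [CommSemiring R] (t : D → R) (f : D) (l : List D) (g : D) :
    pathWeight S t f l g =
      if List.IsChain (fun a b => b ∈ S a) (f :: (l ++ [g])) then ((f :: l).map t).prod else 0 := by
  induction l generalizing f with
  | nil => simp [pathWeight]
  | cons h l ih =>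
    rw [pathWeight, ih]
    simp only [List.cons_append, List.isChain_cons_cons, List.map_cons, List.prod_cons]
    split_ifs <;> simp_all

theorem tsum_list_eq {E : Type*} [NormedAddCommGroup E] [CompleteSpace E] {F : List D → E} (hF : Summable F) :
    ∑' l, F l = F [] + ∑' p : D × List D, F (p.1 :: p.2) := by
  have h1 : Summable (F ∘ (listEquivSum D).symm) := (listEquivSum D).symm.summable_iff.2 hF
  rw [← (listEquivSum D).symm.tsum_eq F]
  have h2 : Summable fun p : D × List D => F (p.1 :: p.2) :=
    h1.comp_injective (i := Sum.inr) Sum.inr_injective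
  have h3 := HasSum.sum (f := fun s => F ((listEquivSum D).symm s))
    (hasSum_unique fun _ : Unit => F []) h2.hasSum
  rw [h3.tsum_eq]

theorem ENNReal.tsum_list_eq (F : List D → ℝ≥0∞) :
    ∑' l, F l = F [] + ∑' (a : D) (l : List D), F (a :: l) := by
  rw [← (listEquivSum D).symm.tsum_eq F, ← ENNReal.tsum_prod]
  have h3 := HasSum.sum (f := fun s => F ((listEquivSum D).symm s))
    (hasSum_unique fun _ : Unit => F [])
    (ENNReal.summable (f := fun p : D × List D => F (p.1 :: p.2))).hasSum
  rw [h3.tsum_eq]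

open Classical in
-- First-step decomposition, truncated in length so that induction is possible before summability is
-- known.
theorem tsum_pathWeight_length_lt_succ (t : D → ℝ≥0∞) (f g : D) (N : ℕ) :
    ∑' l : List D, (if l.length < N + 1 then pathWeight S t f l g else 0) =
      t f * ((if g ∈ S f then 1 else 0) +
        ∑ h ∈ S f, ∑' l : List D, (if l.length < N then pathWeight S t h l g else 0)) := by
  rw [ENNReal.tsum_list_eq, mul_add]
  congr 1
  · simp [pathWeight]
  · rw [tsum_eq_sum (s := S f), Finset.mul_sum]
    · refine Finset.sum_congr rfl fun h hh => ?_
      rw [← ENNReal.tsum_mul_left]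
      refine tsum_congr fun l => ?_
      simp [pathWeight, hh]
    · intro h hh
      simp [pathWeight, hh]

variable {S}

/-- `hC` says that `C` is a supersolution of the first-step recursion, so every truncated sum stays
below `C`; a finite set of lists has bounded length. -/
theorem tsum_pathWeight_const_le (hS : ∀ f, (S f).card ≤ 3) {c C : ℝ≥0} (hC : c * (1 + 3 * C) ≤ C)
    (f g : D) : ∑' l : List D, pathWeight S (fun _ => (c : ℝ≥0∞)) f l g ≤ C := by
  classical
  have key : ∀ N f, ∑' l : List D,
      (if l.length < N then pathWeight S (fun _ => (c : ℝ≥0∞)) f l g else 0) ≤ C := by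
    intro N
    induction N with
    | zero => simp
    | succ N ih =>
      intro f
      rw [tsum_pathWeight_length_lt_succ]
      calc _ ≤ (c : ℝ≥0∞) * (1 + ∑ h ∈ S f, (C : ℝ≥0∞)) := by
            gcongr
            · split_ifs <;> simp
            · exact ih _
        _ ≤ (c : ℝ≥0∞) * (1 + 3 * C) := by
            rw [Finset.sum_const, nsmul_eq_mul]
            gcongr
            exact_mod_cast hS f
        _ ≤ C := by exact_mod_cast hC
  rw [ENNReal.tsum_eq_iSup_sum]
  refine iSup_le fun s => ?_
  refine le_trans ?_ (key (s.sup List.length + 1) f)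
  refine le_trans (Finset.sum_le_sum fun l hl => ?_) (ENNReal.sum_le_tsum s)
  rw [if_pos (Nat.lt_succ_of_le (Finset.le_sup (f := List.length) hl))]

theorem summable_pathWeight_const (hS : ∀ f, (S f).card ≤ 3) {c C : ℝ≥0} (hC : c * (1 + 3 * C) ≤ C)
    (f g : D) : Summable fun l : List D => pathWeight S (fun _ => c) f l g := by
  rw [← ENNReal.tsum_coe_ne_top_iff_summable]
  have h := tsum_pathWeight_const_le hS hC f g
  have h2 : ∀ l, ((pathWeight S (fun _ => c) f l g : ℝ≥0) : ℝ≥0∞) =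
      pathWeight S (fun _ => (c : ℝ≥0∞)) f l g := fun l =>
    map_pathWeight S ENNReal.ofNNRealHom (fun _ => c) f l g
  simp only [h2]
  exact ne_top_of_le_ne_top ENNReal.coe_ne_top h

theorem tsum_pathWeight_const_le' (hS : ∀ f, (S f).card ≤ 3) {c C : ℝ≥0}
    (hC : c * (1 + 3 * C) ≤ C) (f g : D) :
    ∑' l : List D, pathWeight S (fun _ => c) f l g ≤ C := by
  rw [← ENNReal.coe_le_coe, ENNReal.coe_tsum (summable_pathWeight_const hS hC f g)]
  have h2 : ∀ l, ((pathWeight S (fun _ => c) f l g : ℝ≥0) : ℝ≥0∞) =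
      pathWeight S (fun _ => (c : ℝ≥0∞)) f l g := fun l =>
    map_pathWeight S ENNReal.ofNNRealHom (fun _ => c) f l g
  simp only [h2]
  exact tsum_pathWeight_const_le hS hC f g

theorem norm_pathWeight_le {𝕜 : Type*} [NormedField 𝕜] {t : D → 𝕜} {c : ℝ≥0}
    (ht : ∀ f, ‖t f‖₊ ≤ c) (f : D) (l : List D) (g : D) :
    ‖pathWeight S t f l g‖₊ ≤ pathWeight S (fun _ => c) f l g := by
  induction l generalizing f with
  | nil =>
    rw [pathWeight, pathWeight]
    split_ifs
    · exact ht f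
    · simp
  | cons h l ih =>
    rw [pathWeight, pathWeight]
    split_ifs
    · rw [nnnorm_mul]
      exact mul_le_mul' (ht f) (ih h)
    · simp

section Field

variable {𝕜 : Type*} [NormedField 𝕜] {t : D → 𝕜} {c C : ℝ≥0}

theorem summable_pathWeight [CompleteSpace 𝕜] (hS : ∀ f, (S f).card ≤ 3) (hC : c * (1 + 3 * C) ≤ C)
    (ht : ∀ f, ‖t f‖₊ ≤ c) (f g : D) : Summable fun l : List D => pathWeight S t f l g :=
  Summable.of_nnnorm_bounded (summable_pathWeight_const hS hC f g)
    fun l => norm_pathWeight_le ht f l g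

variable (S t) in
open Classical in
/-- The Green function: the sum of the weights of all walks from `f` to `g`. -/
noncomputable def green (f g : D) : 𝕜 :=
  (if f = g then 1 else 0) + ∑' l : List D, pathWeight S t f l g

theorem norm_green_le (hS : ∀ f, (S f).card ≤ 3) (hC : c * (1 + 3 * C) ≤ C)
    (ht : ∀ f, ‖t f‖₊ ≤ c) (f g : D) : ‖green S t f g‖ ≤ 1 + C := by
  have h1 : ‖∑' l : List D, pathWeight S t f l g‖ ≤ C := by
    have h2 := tsum_of_norm_bounded (f := fun l : List D => pathWeight S t f l g)
      (NNReal.hasSum_coe.2 (summable_pathWeight_const hS hC f g).hasSum)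
      fun l => norm_pathWeight_le ht f l g
    exact h2.trans (tsum_pathWeight_const_le' hS hC f g)
  rw [green]
  refine (norm_add_le _ _).trans (add_le_add ?_ h1)
  split_ifs <;> simp

open Classical in
-- First-step equation. The empty list is the direct step from `f` to `g`; it matches the diagonal
-- term of `green S t h g` at `h = g`.
theorem green_eq [CompleteSpace 𝕜] (hS : ∀ f, (S f).card ≤ 3) (hC : c * (1 + 3 * C) ≤ C)
    (ht : ∀ f, ‖t f‖₊ ≤ c) (f g : D) :
    green S t f g = (if f = g then 1 else 0) + t f * ∑ h ∈ S f, green S t h g := by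
  rw [green]
  congr 1
  have hsum := summable_pathWeight hS hC ht f g
  rw [tsum_list_eq hsum]
  have h2 : Summable fun p : D × List D => pathWeight S t f (p.1 :: p.2) g :=
    hsum.comp_injective (i := fun p : D × List D => p.1 :: p.2) (by
      rintro ⟨a, l⟩ ⟨b, l'⟩ h
      simpa using h)
  rw [h2.tsum_prod, tsum_eq_sum (s := S f)]
  · have h3 : ∀ h ∈ S f, ∑' l : List D, pathWeight S t f (h :: l) g =
        t f * ∑' l : List D, pathWeight S t h l g := by
      intro h hh
      rw [← tsum_mul_left]
      exact tsum_congr fun l => by simp [pathWeight, hh]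
    rw [Finset.sum_congr rfl h3, ← Finset.mul_sum]
    simp only [green, Finset.sum_add_distrib, mul_add, pathWeight]
    congr 1
    simp
  · intro h hh
    simp [pathWeight, hh]

/-- Uniqueness for the first-step equation: the transfer operator contracts the sup norm by `3 * c`.
-/
theorem eq_zero_of_forall_eq_mul_sum (hS : ∀ f, (S f).card ≤ 3) (hc : 3 * c < 1)
    (ht : ∀ f, ‖t f‖₊ ≤ c) {v : D → 𝕜} {M : ℝ} (hv : ∀ f, ‖v f‖ ≤ M)
    (h : ∀ f, v f = t f * ∑ h ∈ S f, v h) (f : D) : v f = 0 := by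
  have key : ∀ (n : ℕ) f, ‖v f‖ ≤ (3 * c : ℝ≥0) ^ n * M := by
    intro n
    induction n with
    | zero => simpa using hv
    | succ n ih =>
      intro f
      have hM : 0 ≤ M := (norm_nonneg _).trans (hv f)
      rw [h f, norm_mul]
      have h1 : ‖∑ h ∈ S f, v h‖ ≤ 3 * ((3 * c : ℝ≥0) ^ n * M) := by
        refine (norm_sum_le_of_le _ fun h _ => ih h).trans ?_
        rw [Finset.sum_const, nsmul_eq_mul]
        gcongr
        exact_mod_cast hS f
      calc ‖t f‖ * _ ≤ c * (3 * ((3 * c : ℝ≥0) ^ n * M)) := by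
            gcongr
            exact ht f
        _ = _ := by push_cast; ring
  have hlim : Tendsto (fun n : ℕ => ((3 * c : ℝ≥0) : ℝ) ^ n * M) atTop (𝓝 (0 * M)) :=
    (tendsto_pow_atTop_nhds_zero_of_lt_one (by positivity) (by exact_mod_cast hc)).mul_const M
  rw [zero_mul] at hlim
  exact norm_le_zero_iff.1 (ge_of_tendsto' hlim fun n => key n f)

end Field

end PathWeight

/-! ### Rank-two perturbation of the Green function -/

section Resolvent

variable {D : Type*} {S : D → Finset D}

open Classical in
-- The perturbed Green function $u$ solves the unperturbed first-step equation with extra sources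
-- $(z-1)\alpha$ at $e$ and $(z-1)\beta$ at $e'$, where $\alpha,\beta$ are $x$ times the sums of $u$
-- over the successors of $e,e'$. By uniqueness it is the corresponding combination of unperturbed
-- Green functions, and its values at $e,e'$ give a linear system for $\alpha,\beta$.
theorem tsum_pathWeight_modified {𝕜 : Type*} [NormedField 𝕜] [CompleteSpace 𝕜]
    (hS : ∀ f, (S f).card ≤ 3) {c C : ℝ≥0} (hc : 3 * c < 1)
    (hC : c * (1 + 3 * C) ≤ C) {x : 𝕜} (hx : ‖x‖₊ ≤ c) {z : 𝕜} (hz : ‖z‖₊ ≤ 1) {e e' : D}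
    (hne : e ≠ e') {A B : 𝕜} (hA : green S (fun _ => x) e e = A)
    (hA' : green S (fun _ => x) e' e' = A) (hB : green S (fun _ => x) e e' = B)
    (hB' : green S (fun _ => x) e' e = B) :
    ∃ α β : 𝕜, ∑' l : List D, pathWeight S (fun f => if f = e ∨ f = e' then z * x else x) e l e =
        z * α ∧
      (α + β) * (1 - (z - 1) * (A + B - 1)) = A + B - 1 ∧
      (α - β) * (1 - (z - 1) * (A - B - 1)) = A - B - 1 := by
  set t : D → 𝕜 := fun f => if f = e ∨ f = e' then z * x else x with ht
  have htc : ∀ f, ‖t f‖₊ ≤ c := by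
    intro f
    simp only [ht]
    split_ifs
    · rw [nnnorm_mul]
      calc _ ≤ 1 * c := mul_le_mul' hz hx
        _ = c := one_mul c
    · exact hx
  have hxc : ∀ f : D, ‖(fun _ : D => x) f‖₊ ≤ c := fun _ => hx
  have hte : t e = z * x := by simp [ht]
  have hte' : t e' = z * x := by simp [ht]
  have htf : ∀ f, f ≠ e → f ≠ e' → t f = x := fun f h h' => by simp [ht, h, h']
  have hu := fun f => green_eq hS hC htc f e
  have hG := green_eq hS hC hxc
  set u : D → 𝕜 := fun f => green S t f e with hudef
  set α := x * ∑ h ∈ S e, u h with hα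
  set β := x * ∑ h ∈ S e', u h with hβ
  have hue : u e = 1 + z * α := by
    have := hu e
    rw [if_pos rfl, hte, mul_assoc] at this
    exact this
  have hue' : u e' = z * β := by
    have := hu e'
    rw [if_neg hne.symm, hte', mul_assoc, zero_add] at this
    exact this
  obtain ⟨v, hv⟩ : ∃ v : D → 𝕜, v = fun f => u f - ((1 + (z - 1) * α) *
    green S (fun _ => x) f e + (z - 1) * β * green S (fun _ => x) f e') := ⟨_, rfl⟩
  have hv0 : ∀ f, v f = 0 := by
    have hb := norm_green_le hS hC htc
    have hb' := norm_green_le hS hC hxc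
    refine eq_zero_of_forall_eq_mul_sum hS hc hxc (M := (1 + C) + (‖1 + (z - 1) * α‖ * (1 + C) +
      ‖(z - 1) * β‖ * (1 + C))) (fun f => ?_) fun f => ?_
    · rw [hv]
      refine (norm_sub_le _ _).trans (add_le_add (hb f e) ((norm_add_le _ _).trans ?_))
      rw [norm_mul, norm_mul _ (green _ _ _ _)]
      gcongr
      · exact hb' f e
      · exact hb' f e'
    · have h1 : x * ∑ h ∈ S f, v h = x * ∑ h ∈ S f, u h - ((1 + (z - 1) * α) *
          (x * ∑ h ∈ S f, green S (fun _ => x) h e) +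
          (z - 1) * β * (x * ∑ h ∈ S f, green S (fun _ => x) h e')) := by
        simp only [hv, Finset.sum_sub_distrib, Finset.sum_add_distrib, ← Finset.mul_sum]
        ring
      rw [h1, hv]
      have h2 := hG f e
      have h3 := hG f e'
      have h4 : u f = (if f = e then 1 else 0) + t f * ∑ h ∈ S f, u h := hu f
      simp only
      rw [h2, h3]
      by_cases hf : f = e
      · subst hf
        rw [hue, if_pos rfl, if_neg hne, ← hα]
        ring
      · by_cases hf' : f = e'
        · subst hf'
          rw [hue', if_neg hf, if_pos rfl, ← hβ]
          ring
        · rw [h4, if_neg hf, if_neg hf', htf f hf hf']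
          ring
  have h1 := hv0 e
  have h2 := hv0 e'
  rw [hv] at h1 h2
  simp only at h1 h2
  rw [hue, hA, hB] at h1
  rw [hue', hA', hB'] at h2
  refine ⟨α, β, ?_, ?_, ?_⟩
  · have h3 : u e = 1 + ∑' l : List D, pathWeight S t e l e := by
      simp only [hudef]
      rw [green, if_pos rfl]
    rw [hue] at h3
    exact (add_left_cancel h3).symm
  -- The system is symmetric under exchanging $e$ and $e'$, so sum and difference decouple it.
  · linear_combination h1 + h2
  · linear_combination h1 - h2

end Resolvent

theorem exists_mul_one_add_le {c : ℝ≥0} (hc : 3 * c < 1) : ∃ C : ℝ≥0, c * (1 + 3 * C) ≤ C := by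
  have hc' : 3 * (c : ℝ) < 1 := by exact_mod_cast hc
  -- The fixed point of $C\mapsto c(1+3C)$.
  refine ⟨((c : ℝ) / (1 - 3 * c)).toNNReal, ?_⟩
  rw [← NNReal.coe_le_coe]
  push_cast
  rw [Real.coe_toNNReal _ (div_nonneg c.coe_nonneg (by linarith))]
  have h : (1 - 3 * (c : ℝ)) ≠ 0 := by linarith
  have hy := div_mul_cancel₀ (c : ℝ) h
  refine le_of_eq ?_
  linear_combination -hy

theorem List.prod_map_ite_mul {α R : Type*} [CommSemiring R] (p : α → Prop) [DecidablePred p]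
    (z x : R) (l : List α) :
    (l.map fun a => if p a then z * x else x).prod = x ^ l.length * z ^ l.countP p := by
  induction l with
  | nil => simp
  | cons a l ih =>
    rw [List.map_cons, List.prod_cons, ih, List.countP_cons, List.length_cons]
    by_cases h : p a
    · simp only [h, if_true, decide_true]
      ring
    · simp only [h, if_false, decide_false, Bool.false_eq_true, pow_succ, add_zero]
      ring

/-! ### Loop sums as sums over closed walks -/

namespace SerreGraph

variable {V D : Type*} (G : SerreGraph V D) {S : D → Finset D}

theorem toEdge_eq_iff (f a : D) : G.toEdge f = G.toEdge a ↔ f = a ∨ f = G.rev a :=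
  Quotient.eq (r := G.edgeSetoid)

open Classical in
-- `l ↦ a :: l` identifies the closed walks from `a` with the rooted loops starting at `a`; terms
-- outside either family vanish.
theorem hasSum_rootedLoop_head (hS : ∀ f h, h ∈ S f ↔ G.Step f h) {R : Type*} [CommSemiring R]
    [TopologicalSpace R] (t : D → R) (a : D) {s : R}
    (h : HasSum (fun l => pathWeight S t a l a) s) :
    HasSum (fun ω : G.RootedLoop => if ω.edges.head? = some a then (ω.edges.map t).prod else 0)
      s := by
  let F : List D → R := fun L =>
    if L.head? = some a ∧ (L : Cycle D).Chain G.Step then (L.map t).prod else 0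
  have h1 : (fun ω : G.RootedLoop => if ω.edges.head? = some a then (ω.edges.map t).prod else 0) =
      F ∘ RootedLoop.edges := by
    funext ω
    simp [F, ω.chain]
  have hj : Function.Injective (fun l : List D => a :: l) := fun l l' h => by simpa using h
  have h2 : (fun l => pathWeight S t a l a) = F ∘ fun l : List D => a :: l := by
    funext l
    rw [pathWeight_eq_prod]
    simp [F, hS, Cycle.chain_coe_cons]
  rw [h1, (RootedLoop.edges_injective G).hasSum_iff]
  · rwa [h2, hj.hasSum_iff] at h
    intro L hL
    refine if_neg fun hL' => hL ?_
    obtain ⟨b, l, rfl⟩ := List.exists_cons_of_ne_nil (l := L) (by rintro rfl; simp at hL')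
    refine ⟨l, ?_⟩
    have := hL'.1
    simp only [List.head?_cons, Option.some.injEq] at this
    rw [this]
  · intro L hL
    refine if_neg fun hL' => hL ?_
    exact ⟨⟨L, by rintro rfl; simp at hL', hL'.2⟩, rfl⟩

open Classical in
theorem hasSum_rootedLoop_rootedAt (hS : ∀ f h, h ∈ S f ↔ G.Step f h) {R : Type*} [CommSemiring R]
    [TopologicalSpace R] [ContinuousAdd R] (t : D → R) (a : D) {s s' : R}
    (h : HasSum (fun l => pathWeight S t a l a) s)
    (h' : HasSum (fun l => pathWeight S t (G.rev a) l (G.rev a)) s') :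
    HasSum (fun ω : G.RootedLoop =>
      if G.RootedAt (G.toEdge a) ω.edges then (ω.edges.map t).prod else 0) (s + s') := by
  convert (G.hasSum_rootedLoop_head hS t a h).add (G.hasSum_rootedLoop_head hS t (G.rev a) h')
    using 1
  funext ω
  obtain ⟨b, l, hbl⟩ := List.exists_cons_of_ne_nil ω.ne_nil
  have hne := G.rev_ne a
  simp only [RootedAt, hbl, List.head?_cons, Option.mem_def, Option.some.injEq, exists_eq_left',
    toEdge_eq_iff]
  by_cases h1 : b = a
  · subst h1
    simp [hne.symm]
  · simp [h1]

theorem weight_const (x : ℝ≥0) (ω : G.RootedLoop) :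
    G.weight (fun _ => x) ω = x ^ ω.edges.length := by
  rw [weight_eq]
  simp

theorem meanOccupation_eq_tsum [Countable D] (x : G.Edge → ℝ≥0) (e : G.Edge) :
    G.meanOccupation x e = ∑' ℓ, (G.loopMeasure x ℓ : ℝ≥0∞) * (G.visits e ℓ : ℝ≥0∞) :=
  lintegral_tsum_infinitePi_poissonMeasure _ _

theorem two_mul_meanOccupation [Countable D] (hS : ∀ f h, h ∈ S f ↔ G.Step f h) (x : ℝ≥0) (a : D) :
    2 * G.meanOccupation (fun _ => x) (G.toEdge a) =
      ∑' l : List D, pathWeight S (fun _ => (x : ℝ≥0∞)) a l a +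
        ∑' l : List D, pathWeight S (fun _ => (x : ℝ≥0∞)) (G.rev a) l (G.rev a) := by
  classical
  rw [← (G.hasSum_rootedLoop_rootedAt hS (fun _ => (x : ℝ≥0∞)) a ENNReal.summable.hasSum
    ENNReal.summable.hasSum).tsum_eq, meanOccupation_eq_tsum, ← ENNReal.tsum_mul_left]
  have h := (G.tsum_rootedAt_fiberwise (G.toEdge a)
    (fun ℓ => (G.weight (fun _ => x) (Quotient.out ℓ) : ℝ≥0∞)) ENNReal.summable
    fun _ => ENNReal.summable).tsum_eq
  simp only [weight_out] at h
  convert h using 1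
  · refine tsum_congr fun ℓ => ?_
    rw [nsmul_eq_mul]
    exact_mod_cast (G.rootedCount_mul_weight (fun _ => x) (G.toEdge a) ℓ).symm
  · refine tsum_congr fun ω => ?_
    rw [weight_const]
    simp

/-- The derivative in $z$ of the exponent $\sum_\ell\mu(\ell)(z^{N_\ell}-1)$. Giving `a` and `G.rev
a` the weight $zx$ multiplies each loop weight by $z^{N_\ell}$, so the perturbed closed-walk sums
apply. -/
theorem tsum_loopMeasure_mul_visits_mul_pow (hS : ∀ f h, h ∈ S f ↔ G.Step f h)
    (hcard : ∀ f, (S f).card ≤ 3) {x : ℝ≥0} (hx : 3 * x < 1) (a : D) {A B : ℝ}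
    (hA : green S (fun _ => (x : ℝ)) a a = A)
    (hA' : green S (fun _ => (x : ℝ)) (G.rev a) (G.rev a) = A)
    (hB : green S (fun _ => (x : ℝ)) a (G.rev a) = B)
    (hB' : green S (fun _ => (x : ℝ)) (G.rev a) a = B) {z : ℂ} (hz : ‖z‖ ≤ 1) (hz0 : z ≠ 0)
    (h1 : 1 - (z - 1) * ((A + B - 1 : ℝ) : ℂ) ≠ 0) (h2 : 1 - (z - 1) * ((A - B - 1 : ℝ) : ℂ) ≠ 0) :
    ∑' ℓ, (G.loopMeasure (fun _ => x) ℓ : ℂ) *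
      (G.visits (G.toEdge a) ℓ * z ^ (G.visits (G.toEdge a) ℓ - 1)) =
    (1 / 2 : ℂ) * (((A + B - 1 : ℝ) : ℂ) / (1 - (z - 1) * ((A + B - 1 : ℝ) : ℂ)) +
      ((A - B - 1 : ℝ) : ℂ) / (1 - (z - 1) * ((A - B - 1 : ℝ) : ℂ))) := by
  classical
  obtain ⟨C, hC⟩ := exists_mul_one_add_le hx
  have hcast : ∀ f g, green S (fun _ => (x : ℂ)) f g =
      ((green S (fun _ => (x : ℝ)) f g : ℝ) : ℂ) := by
    intro f g
    rw [green, green]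
    push_cast
    congr 1
    · split_ifs <;> simp
    · refine tsum_congr fun l => ?_
      exact (map_pathWeight S Complex.ofRealHom (fun _ => (x : ℝ)) f l g).symm
  have hxn : ‖(x : ℂ)‖₊ ≤ x := by
    rw [← NNReal.coe_le_coe]
    simp
  have hzn : ‖z‖₊ ≤ 1 := by exact_mod_cast hz
  have hne : a ≠ G.rev a := (G.rev_ne a).symm
  set t : D → ℂ := fun f => if f = a ∨ f = G.rev a then z * x else x with ht
  have htc : ∀ f, ‖t f‖₊ ≤ x := by
    intro f
    simp only [ht]
    split_ifs
    · rw [nnnorm_mul]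
      calc _ ≤ 1 * x := mul_le_mul' hzn hxn
        _ = x := one_mul x
    · exact hxn
  obtain ⟨α, β, hα, hs, hd⟩ := tsum_pathWeight_modified hcard hx hC hxn hzn hne
    (by rw [hcast, hA]) (by rw [hcast, hA']) (by rw [hcast, hB]) (by rw [hcast, hB'])
  obtain ⟨α', β', hα', hs', hd'⟩ := tsum_pathWeight_modified hcard hx hC hxn hzn hne.symm
    (by rw [hcast, hA']) (by rw [hcast, hA]) (by rw [hcast, hB']) (by rw [hcast, hB])
  have ht' : (fun f => if f = G.rev a ∨ f = a then z * (x : ℂ) else x) = t := by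
    funext f
    simp only [ht, or_comm]
  rw [ht'] at hα'
  have hsum := summable_pathWeight hcard hC htc
  have hroot := G.hasSum_rootedLoop_rootedAt hS t a (hsum a a).hasSum
    (hsum (G.rev a) (G.rev a)).hasSum
  rw [hα, hα'] at hroot
  have hterm : ∀ ω : G.RootedLoop, (ω.edges.map t).prod =
      (fun ℓ : G.Loop => (G.weight (fun _ => x) (Quotient.out ℓ) : ℂ) *
        z ^ G.visits (G.toEdge a) ℓ) (G.toLoop ω) := by
    intro ω
    simp only [weight_out, weight_const]
    rw [ht, List.prod_map_ite_mul]
    push_cast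
    congr 2
    change _ = G.rootedVisits (G.toEdge a) ω
    rw [rootedVisits]
    refine List.countP_congr fun f _ => ?_
    simp [toEdge_eq_iff]
  simp only [hterm] at hroot
  have hloop := G.tsum_rootedAt_fiberwise (G.toEdge a) (fun ℓ : G.Loop =>
    (G.weight (fun _ => x) (Quotient.out ℓ) : ℂ) * z ^ G.visits (G.toEdge a) ℓ) hroot.summable
    fun ℓ => hroot.summable.subtype _
  rw [hroot.tsum_eq] at hloop
  have hval : α = (1 / 2 : ℂ) * (((A + B - 1 : ℝ) : ℂ) / (1 - (z - 1) * ((A + B - 1 : ℝ) : ℂ)) +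
      ((A - B - 1 : ℝ) : ℂ) / (1 - (z - 1) * ((A - B - 1 : ℝ) : ℂ))) := by
    push_cast at h1 h2 ⊢
    rw [← eq_div_iff h1] at hs
    rw [← eq_div_iff h2] at hd
    rw [← hs, ← hd]
    ring
  have hval' : α' = (1 / 2 : ℂ) * (((A + B - 1 : ℝ) : ℂ) / (1 - (z - 1) * ((A + B - 1 : ℝ) : ℂ)) +
      ((A - B - 1 : ℝ) : ℂ) / (1 - (z - 1) * ((A - B - 1 : ℝ) : ℂ))) := by
    push_cast at h1 h2 ⊢
    rw [← eq_div_iff h1] at hs'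
    rw [← eq_div_iff h2] at hd'
    rw [← hs', ← hd']
    ring
  rw [← hval] at hval' ⊢
  rw [hval'] at hloop
  -- The 2 accounts for the two orientations of the root, the $z$ for the power lost by
  -- differentiating.
  have h3 := (hloop.mul_left (2 * z)⁻¹).tsum_eq
  convert h3 using 1
  · refine tsum_congr fun ℓ => ?_
    have h4 : ((G.rootedCount (G.toEdge a) ℓ : ℝ≥0) : ℂ) *
        (G.weight (fun _ => x) (Quotient.out ℓ) : ℂ) =
        2 * ((G.loopMeasure (fun _ => x) ℓ : ℂ) * (G.visits (G.toEdge a) ℓ : ℂ)) := by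
      exact_mod_cast congrArg (fun r : ℝ≥0 => (r : ℂ))
        (G.rootedCount_mul_weight (fun _ => x) (G.toEdge a) ℓ)
    rw [nsmul_eq_mul, ← mul_assoc (_ : ℂ) (G.weight _ _ : ℂ)]
    push_cast at h4
    rw [h4]
    -- The truncated exponent $N_\ell-1$ at $N_\ell=0$ is harmless because of the factor $N_\ell$.
    rcases Nat.eq_zero_or_pos (G.visits (G.toEdge a) ℓ) with h0 | h0
    · simp [h0]
    · obtain ⟨n, hn⟩ : ∃ n, G.visits (G.toEdge a) ℓ = n + 1 := ⟨_, (Nat.sub_add_cancel h0).symm⟩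
      rw [hn, pow_succ, Nat.add_sub_cancel]
      field_simp
  · field_simp
    ring

end SerreGraph

/-! ### Integration of the exponent -/

theorem norm_pow_sub_one_le {w : ℂ} (hw : ‖w‖ ≤ 1) (n : ℕ) : ‖w ^ n - 1‖ ≤ n * ‖w - 1‖ := by
  induction n with
  | zero => simp
  | succ n ih =>
    have h : w ^ (n + 1) - 1 = w ^ n * (w - 1) + (w ^ n - 1) := by ring
    rw [h]
    refine (norm_add_le _ _).trans ?_
    rw [norm_mul, norm_pow]
    have h1 : ‖w‖ ^ n * ‖w - 1‖ ≤ 1 * ‖w - 1‖ :=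
      mul_le_mul_of_nonneg_right (pow_le_one₀ (norm_nonneg w) hw) (norm_nonneg _)
    push_cast
    linarith

/-- The real part of $w-1$ lies in $(-1,0]$. Positivity keeps the principal logarithm away from its
cut. -/
theorem re_one_sub_mul_pos {w : ℂ} (hw : ‖w‖ ≤ 1) (hw' : ‖w - 1‖ < 1) {g : ℝ} (hg : -1 ≤ g) :
    0 < (1 - (w - 1) * (g : ℂ)).re := by
  have h1 : w.re ≤ 1 := (Complex.re_le_norm w).trans hw
  have h2 : |(w - 1).re| < 1 := (Complex.abs_re_le_norm _).trans_lt hw'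
  simp only [Complex.sub_re, Complex.one_re, Complex.mul_re, Complex.ofReal_re, Complex.ofReal_im,
    mul_zero, sub_zero] at h2 ⊢
  rw [abs_lt] at h2
  rcases le_or_gt 0 g with h | h <;> nlinarith

/-- Both sides vanish at $1$ and have the same derivative along the segment from $1$ to $z$. That
segment stays in the closed unit disc, where the series and its derivative are dominated by `m i * N
i`, and within distance less than $1$ of $1$, where the logarithms are smooth. -/
theorem tsum_mul_pow_sub_one_eq_log {ι : Type*} {m : ι → ℝ} (hm : ∀ i, 0 ≤ m i) {N : ι → ℕ}
    (hsum : Summable fun i => m i * N i) {g h : ℝ} (hg : -1 ≤ g) (hh : -1 ≤ h)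
    (hderiv : ∀ w : ℂ, ‖w‖ ≤ 1 → ‖w - 1‖ < 1 → ∑' i, (m i : ℂ) * (N i * w ^ (N i - 1)) =
      (1 / 2 : ℂ) * ((g : ℂ) / (1 - (w - 1) * (g : ℂ)) + (h : ℂ) / (1 - (w - 1) * (h : ℂ))))
    {z : ℂ} (hz : ‖z‖ ≤ 1) (hz' : ‖z - 1‖ < 1) :
    ∑' i, (m i : ℂ) * (z ^ N i - 1) =
      -(1 / 2 : ℂ) * (Complex.log (1 - (z - 1) * (g : ℂ)) + Complex.log (1 - (z - 1) * (h : ℂ))) := by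
  set W : ℝ → ℂ := fun t => 1 + t * (z - 1) with hW
  have hWd : ∀ t, HasDerivAt W (z - 1) t := by
    intro t
    have h1 : HasDerivAt (fun t : ℝ => (t : ℂ)) 1 t := Complex.ofRealCLM.hasDerivAt
    have h2 := (h1.mul_const (z - 1)).const_add 1
    rwa [one_mul] at h2
  have hWc : Continuous W := by fun_prop
  have hW1 : ∀ t ∈ Set.Icc (0 : ℝ) 1, ‖W t‖ ≤ 1 := by
    intro t ht
    have h1 : W t = ((1 - t : ℝ) : ℂ) + (t : ℂ) * z := by
      simp only [hW]
      push_cast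
      ring
    rw [h1]
    refine (norm_add_le _ _).trans ?_
    rw [norm_mul, Complex.norm_real, Complex.norm_real, Real.norm_of_nonneg ht.1,
      Real.norm_of_nonneg (by linarith [ht.2])]
    nlinarith [ht.1]
  have hW2' : ∀ t ∈ Set.Icc (0 : ℝ) 1, ‖W t - 1‖ ≤ ‖z - 1‖ := by
    intro t ht
    simp only [hW, add_sub_cancel_left, norm_mul, Complex.norm_real]
    rw [Real.norm_of_nonneg ht.1]
    nlinarith [norm_nonneg (z - 1), ht.2]
  have hW2 : ∀ t ∈ Set.Icc (0 : ℝ) 1, ‖W t - 1‖ < 1 := fun t ht => (hW2' t ht).trans_lt hz'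
  have hbound : ∀ i, ∀ t ∈ Set.Icc (0 : ℝ) 1, ‖(m i : ℂ) * (W t ^ N i - 1)‖ ≤ m i * N i := by
    intro i t ht
    rw [norm_mul, Complex.norm_real, Real.norm_of_nonneg (hm i)]
    refine mul_le_mul_of_nonneg_left ((norm_pow_sub_one_le (hW1 t ht) _).trans ?_) (hm i)
    nlinarith [hW2 t ht, (Nat.cast_nonneg (N i) : (0 : ℝ) ≤ N i)]
  have hmem : ∀ k : ℝ, -1 ≤ k → ∀ t ∈ Set.Icc (0 : ℝ) 1,
      (1 - (W t - 1) * (k : ℂ)) ∈ Complex.slitPlane := fun k hk t ht =>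
    Or.inl (re_one_sub_mul_pos (hW1 t ht) (hW2 t ht) hk)
  set Φ : ℝ → ℂ := fun t => ∑' i, (m i : ℂ) * (W t ^ N i - 1) + (1 / 2 : ℂ) *
    (Complex.log (1 - (W t - 1) * (g : ℂ)) + Complex.log (1 - (W t - 1) * (h : ℂ))) with hΦ
  have hcont : ContinuousOn Φ (Set.Icc 0 1) := by
    refine ContinuousOn.add ?_ (ContinuousOn.mul continuousOn_const (ContinuousOn.add ?_ ?_))
    · exact continuousOn_tsum (fun i => by fun_prop) hsum hbound
    · exact ContinuousOn.clog (by fun_prop) (hmem g hg)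
    · exact ContinuousOn.clog (by fun_prop) (hmem h hh)
  have hlog : ∀ k : ℝ, -1 ≤ k → ∀ t ∈ Set.Icc (0 : ℝ) 1,
      HasDerivAt (fun t => Complex.log (1 - (W t - 1) * (k : ℂ)))
        (-((z - 1) * k) / (1 - (W t - 1) * (k : ℂ))) t := by
    intro k hk t ht
    exact ((((hWd t).sub_const 1).mul_const (k : ℂ)).const_sub 1).clog_real (hmem k hk t ht)
  have hd : ∀ t ∈ Set.Ioo (0 : ℝ) 1, HasDerivAt Φ 0 t := by
    intro t ht
    have ht' := Set.Ioo_subset_Icc_self ht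
    have h1 : HasDerivAt (fun t => ∑' i, (m i : ℂ) * (W t ^ N i - 1))
        (∑' i, (m i : ℂ) * (N i * W t ^ (N i - 1) * (z - 1))) t := by
      refine hasDerivAt_tsum_of_isPreconnected (g := fun i t => (m i : ℂ) * (W t ^ N i - 1))
        (g' := fun i t => (m i : ℂ) * (N i * W t ^ (N i - 1) * (z - 1)))
        (u := fun i => m i * N i) hsum isOpen_Ioo
        isPreconnected_Ioo (fun i y _ => ?_) (fun i y hy => ?_) ht ?_ ht
      · exact (((hWd y).pow (N i)).sub_const 1).const_mul _
      · have hy' := Set.Ioo_subset_Icc_self hy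
        rw [norm_mul, Complex.norm_real, Real.norm_of_nonneg (hm i), norm_mul, norm_mul, norm_pow,
          Complex.norm_natCast]
        have h2 : ‖W y‖ ^ (N i - 1) ≤ 1 := pow_le_one₀ (norm_nonneg _) (hW1 y hy')
        refine mul_le_mul_of_nonneg_left ?_ (hm i)
        calc (N i : ℝ) * ‖W y‖ ^ (N i - 1) * ‖z - 1‖ ≤ N i * 1 * 1 := by gcongr
          _ = N i := by ring
      · exact Summable.of_norm_bounded hsum fun i => hbound i t ht'
    have h2 : ∑' i, (m i : ℂ) * (N i * W t ^ (N i - 1) * (z - 1)) =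
        (∑' i, (m i : ℂ) * (N i * W t ^ (N i - 1))) * (z - 1) := by
      rw [← tsum_mul_right]
      exact tsum_congr fun i => by ring
    rw [h2, hderiv _ (hW1 t ht') (hW2 t ht')] at h1
    have h3 := h1.add (((hlog g hg t ht').add (hlog h hh t ht')).const_mul (1 / 2 : ℂ))
    refine h3.congr_deriv ?_
    ring
  have hint := intervalIntegral.integral_eq_sub_of_hasDerivAt_of_le zero_le_one hcont hd
    (by simp)
  have h0 : Φ 0 = 0 := by simp [hΦ, hW]
  rw [h0, intervalIntegral.integral_zero, sub_zero] at hint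
  have h1 : W 1 = z := by simp [hW]
  simp only [hΦ, h1] at hint
  linear_combination -hint

/-! ### Walk counts and the Green function near the critical weight -/

section WalkCount

variable {D : Type*} (S : D → Finset D)

open Classical in
/-- The number of walks with `n` steps from `f` to `g`. -/
noncomputable def walkCount : ℕ → D → D → ℕ
  | 0, f, g => if f = g then 1 else 0
  | n + 1, f, g => ∑ h ∈ S f, walkCount n h g

theorem tsum_walkCount_succ_mul (n : ℕ) (f : D) (F : D → ℝ≥0∞) :
    ∑' g, (walkCount S (n + 1) f g : ℝ≥0∞) * F g =
      ∑ h ∈ S f, ∑' g, (walkCount S n h g : ℝ≥0∞) * F g := by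
  simp only [walkCount, Nat.cast_sum, Finset.sum_mul]
  exact Summable.tsum_finsetSum fun _ _ => ENNReal.summable

theorem tsum_walkCount_zero_mul (f : D) (F : D → ℝ≥0∞) :
    ∑' g, (walkCount S 0 f g : ℝ≥0∞) * F g = F f := by
  classical
  rw [tsum_eq_single f fun g hg => by simp [walkCount, hg.symm]]
  simp [walkCount]

theorem walkCount_add (m n : ℕ) (f g : D) :
    (walkCount S (m + n) f g : ℝ≥0∞) =
      ∑' h, (walkCount S m f h : ℝ≥0∞) * (walkCount S n h g : ℝ≥0∞) := by
  induction m generalizing f with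
  | zero => rw [tsum_walkCount_zero_mul, zero_add]
  | succ m ih =>
    rw [tsum_walkCount_succ_mul, Nat.add_right_comm, walkCount]
    push_cast
    exact Finset.sum_congr rfl fun h _ => ih h

theorem sum_walkCount_mul_le (m n : ℕ) (f g : D) (s : Finset D) :
    ∑ h ∈ s, walkCount S m f h * walkCount S n h g ≤ walkCount S (m + n) f g := by
  have h := ENNReal.sum_le_tsum (f := fun h => (walkCount S m f h : ℝ≥0∞) * walkCount S n h g) s
  rw [← walkCount_add] at h
  exact_mod_cast h

theorem walkCount_mul_le (m n : ℕ) (f h g : D) :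
    walkCount S m f h * walkCount S n h g ≤ walkCount S (m + n) f g := by
  simpa using sum_walkCount_mul_le S m n f g {h}

/-- For the walk choosing uniformly among three successors, `F` has constant drift `c`; this is its
expectation after `n` steps, times the number of walks. -/
theorem tsum_walkCount_mul_eq {F : D → ℝ≥0∞} {c : ℝ≥0∞} (hS : ∀ f, (S f).card = 3)
    (hF : ∀ f, ∑ h ∈ S f, F h = 3 * (F f + c)) (n : ℕ) (f : D) :
    ∑' g, (walkCount S n f g : ℝ≥0∞) * F g = 3 ^ n * (F f + n * c) := by
  induction n generalizing f with
  | zero => rw [tsum_walkCount_zero_mul]; simp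
  | succ n ih =>
    rw [tsum_walkCount_succ_mul, Finset.sum_congr rfl fun h _ => ih h, ← Finset.mul_sum,
      Finset.sum_add_distrib, hF, Finset.sum_const, hS, nsmul_eq_mul]
    push_cast
    ring

theorem walkCount_pos_succ {n : ℕ} {f h g : D} (hh : h ∈ S f) (hn : 0 < walkCount S n h g) :
    0 < walkCount S (n + 1) f g := by
  rw [walkCount]
  exact Finset.sum_pos' (fun _ _ => Nat.zero_le _) ⟨h, hh, hn⟩

theorem walkCount_self_zero (f : D) : 0 < walkCount S 0 f f := by simp [walkCount]

theorem walkCount_succ_right (n : ℕ) (f g : D) :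
    (walkCount S (n + 1) f g : ℝ≥0∞) =
      ∑' h, (walkCount S n f h : ℝ≥0∞) * (walkCount S 1 h g : ℝ≥0∞) := walkCount_add S n 1 f g

/-- Time reversal: the last step of the reversed walk is the first step of the original one. -/
theorem walkCount_rev {r : D → D} (hr : ∀ f, r (r f) = f)
    (hS : ∀ f g, g ∈ S f → r f ∈ S (r g)) (n : ℕ) (f g : D) :
    walkCount S n (r g) (r f) = walkCount S n f g := by
  classical
  have hS' : ∀ f g, r g ∈ S (r f) ↔ f ∈ S g := fun f g =>
    ⟨fun h => by simpa only [hr] using hS _ _ h, hS _ _⟩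
  have hrinj : Function.Injective r := Function.LeftInverse.injective hr
  induction n generalizing f g with
  | zero =>
    simp only [walkCount]
    exact if_congr (hrinj.eq_iff.trans eq_comm) rfl rfl
  | succ n ih =>
    have h1 : (walkCount S (n + 1) (r g) (r f) : ℝ≥0∞) = walkCount S (n + 1) f g := by
      rw [walkCount_succ_right, ← (Equiv.mk r r hr hr).tsum_eq]
      have h2 : ∀ h, (walkCount S n (r g) ((Equiv.mk r r hr hr) h) : ℝ≥0∞) *
          (walkCount S 1 ((Equiv.mk r r hr hr) h) (r f) : ℝ≥0∞) =
          (walkCount S 1 f h : ℝ≥0∞) * (walkCount S n h g : ℝ≥0∞) := by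
        intro h
        change (walkCount S n (r g) (r h) : ℝ≥0∞) * (walkCount S 1 (r h) (r f) : ℝ≥0∞) = _
        rw [ih, mul_comm]
        congr 2
        simp only [walkCount, Finset.sum_ite_eq', hS']
      rw [tsum_congr h2, ← walkCount_add, add_comm]
    exact_mod_cast h1

variable {S}

/-- Partial sums of the Neumann series; this lower bound suffices for positivity and for divergence.
-/
theorem sum_pow_mul_walkCount_le_green (hS : ∀ f, (S f).card ≤ 3) {x : ℝ≥0} (hx : 3 * x < 1)
    (N : ℕ) (f g : D) :
    ∑ n ∈ Finset.range N, (x : ℝ) ^ n * walkCount S n f g ≤ green S (fun _ => (x : ℝ)) f g := by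
  classical
  obtain ⟨C, hC⟩ := exists_mul_one_add_le hx
  have hg := green_eq hS hC (t := fun _ => (x : ℝ)) (fun _ => by simp)
  induction N generalizing f with
  | zero =>
    rw [Finset.sum_range_zero, green]
    refine add_nonneg (by split_ifs <;> simp) (tsum_nonneg fun l => ?_)
    have := map_pathWeight S NNReal.toRealHom (fun _ => x) f l g
    rw [show (fun _ : D => (x : ℝ)) = fun _ => NNReal.toRealHom x from rfl, ← this]
    exact NNReal.coe_nonneg _
  | succ N ih =>
    rw [hg, Finset.sum_range_succ', add_comm]
    refine add_le_add (by simp [walkCount]) ?_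
    rw [Finset.mul_sum]
    have h1 : ∀ n ∈ Finset.range N, (x : ℝ) ^ (n + 1) * walkCount S (n + 1) f g =
        ∑ h ∈ S f, x * ((x : ℝ) ^ n * walkCount S n h g) := by
      intro n _
      rw [walkCount]
      push_cast
      rw [Finset.mul_sum]
      exact Finset.sum_congr rfl fun h _ => by ring
    rw [Finset.sum_congr rfl h1, Finset.sum_comm]
    refine Finset.sum_le_sum fun h _ => ?_
    rw [← Finset.mul_sum]
    exact mul_le_mul_of_nonneg_left (ih h) x.coe_nonneg

theorem green_nonneg (hS : ∀ f, (S f).card ≤ 3) {x : ℝ≥0} (hx : 3 * x < 1) (f g : D) :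
    0 ≤ green S (fun _ => (x : ℝ)) f g := by
  simpa using sum_pow_mul_walkCount_le_green hS hx 0 f g

/-- Maximum principle: away from `g` the value is `x` times a sum of at most three values, and `3 *
x < 1`. Iterating the crude bound `1 + C` shrinks the excess over the value at `g` geometrically. -/
theorem green_le_green_self (hS : ∀ f, (S f).card ≤ 3) {x : ℝ≥0} (hx : 3 * x < 1) (f g : D) :
    green S (fun _ => (x : ℝ)) f g ≤ green S (fun _ => (x : ℝ)) g g := by
  classical
  obtain ⟨C, hC⟩ := exists_mul_one_add_le hx
  have hxc : ∀ f : D, ‖(fun _ : D => (x : ℝ)) f‖₊ ≤ x := fun _ => by simp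
  have hg := green_eq hS hC hxc
  set M := green S (fun _ => (x : ℝ)) g g with hM
  have hM0 : 0 ≤ M := green_nonneg hS hx g g
  have hx' : 3 * (x : ℝ) < 1 := by exact_mod_cast hx
  have key : ∀ (n : ℕ) f, green S (fun _ => (x : ℝ)) f g ≤ M + (3 * (x : ℝ)) ^ n * (1 + C) := by
    intro n
    induction n with
    | zero =>
      intro f
      have := (le_abs_self _).trans (norm_green_le hS hC hxc f g)
      simpa using this.trans (le_add_of_nonneg_left hM0)
    | succ n ih =>
      intro f
      have hpos : 0 ≤ (3 * (x : ℝ)) ^ (n + 1) * (1 + C) := by positivity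
      by_cases hf : f = g
      · rw [hf]
        linarith
      · rw [hg, if_neg hf, zero_add]
        have h1 : ∑ h ∈ S f, green S (fun _ => (x : ℝ)) h g ≤
            3 * (M + (3 * (x : ℝ)) ^ n * (1 + C)) := by
          refine (Finset.sum_le_sum fun h _ => ih h).trans ?_
          rw [Finset.sum_const, nsmul_eq_mul]
          gcongr
          exact_mod_cast hS f
        calc (x : ℝ) * _ ≤ x * (3 * (M + (3 * (x : ℝ)) ^ n * (1 + C))) :=
              mul_le_mul_of_nonneg_left h1 x.coe_nonneg
          _ = 3 * x * M + (3 * (x : ℝ)) ^ (n + 1) * (1 + C) := by ring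
          _ ≤ _ := by nlinarith
  have hlim : Tendsto (fun n : ℕ => M + (3 * (x : ℝ)) ^ n * (1 + C)) atTop
      (𝓝 (M + 0 * (1 + C))) :=
    ((tendsto_pow_atTop_nhds_zero_of_lt_one (by positivity) hx').mul_const _).const_add M
  rw [zero_mul, add_zero] at hlim
  exact ge_of_tendsto' hlim fun n => key n f

theorem three_mul_lt_one {x : ℝ≥0} (hx : x < 1 / 3) : 3 * x < 1 := by
  rw [lt_div_iff₀ (by norm_num)] at hx
  rwa [mul_comm]

/-- A partial sum that is large at $1/3$ is a polynomial in $x$, hence still large nearby. -/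
theorem tendsto_green_atTop (hS : ∀ f, (S f).card ≤ 3) {f g : D}
    (h : Tendsto (fun N => ∑ n ∈ Finset.range N, (1 / 3 : ℝ) ^ n * walkCount S n f g) atTop atTop) :
    Tendsto (fun x : ℝ≥0 => green S (fun _ => (x : ℝ)) f g) (𝓝[<] (1 / 3)) atTop := by
  rw [tendsto_atTop]
  intro b
  obtain ⟨N, hN⟩ := (h.eventually_gt_atTop b).exists
  have hc : Continuous fun x : ℝ≥0 => ∑ n ∈ Finset.range N, (x : ℝ) ^ n * walkCount S n f g := by
    fun_prop
  have h1 : ∀ᶠ x : ℝ≥0 in 𝓝 (1 / 3), b < ∑ n ∈ Finset.range N, (x : ℝ) ^ n * walkCount S n f g := by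
    refine (hc.tendsto _).eventually_const_lt ?_
    simpa using hN
  filter_upwards [nhdsWithin_le_nhds h1, self_mem_nhdsWithin] with x hx hx'
  exact hx.le.trans (sum_pow_mul_walkCount_le_green hS (three_mul_lt_one hx') N f g)

/-- The ratios are at most 1 and, in the limit, each is the average of those at its three
successors, since the diagonal term is divided by a diverging quantity. So a ratio tending to 1
forces the same at all successors, and this propagates along a walk from `b` to `a`. -/
theorem tendsto_green_div_green (hS : ∀ f, (S f).card = 3) {a b : D}
    (hb : Tendsto (fun x : ℝ≥0 => green S (fun _ => (x : ℝ)) b b) (𝓝[<] (1 / 3)) atTop)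
    {n : ℕ} (hn : 0 < walkCount S n b a) :
    Tendsto (fun x : ℝ≥0 => green S (fun _ => (x : ℝ)) a b / green S (fun _ => (x : ℝ)) b b)
      (𝓝[<] (1 / 3)) (𝓝 1) := by
  classical
  have hS' : ∀ f, (S f).card ≤ 3 := fun f => (hS f).le
  set q : D → ℝ≥0 → ℝ := fun f x =>
    green S (fun _ => (x : ℝ)) f b / green S (fun _ => (x : ℝ)) b b with hq
  have hpos : ∀ᶠ x : ℝ≥0 in 𝓝[<] (1 / 3), 0 < green S (fun _ => (x : ℝ)) b b :=
    hb.eventually_gt_atTop 0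
  have hxlim : Tendsto (fun x : ℝ≥0 => (x : ℝ)) (𝓝[<] (1 / 3)) (𝓝 (1 / 3)) := by
    have h1 : Tendsto (fun x : ℝ≥0 => (x : ℝ)) (𝓝 (1 / 3)) (𝓝 ((1 / 3 : ℝ≥0) : ℝ)) :=
      NNReal.continuous_coe.tendsto _
    have h2 := h1.mono_left (nhdsWithin_le_nhds (s := Set.Iio (1 / 3)))
    simpa using h2
  have hstep : ∀ f, Tendsto (q f) (𝓝[<] (1 / 3)) (𝓝 1) → ∀ h ∈ S f,
      Tendsto (q h) (𝓝[<] (1 / 3)) (𝓝 1) := by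
    intro f hf h hh
    -- The quotient by `x` is the sum over all three successors, with limit 3; the two successors
    -- other than `h` contribute at most 2.
    have hlow : Tendsto (fun x : ℝ≥0 => (q f x - (if f = b then 1 else 0) *
        (green S (fun _ => (x : ℝ)) b b)⁻¹) / x - 2) (𝓝[<] (1 / 3)) (𝓝 1) := by
      have h1 := ((hf.sub (hb.inv_tendsto_atTop.const_mul (if f = b then 1 else 0 : ℝ))).div hxlim
        (by norm_num)).sub_const 2
      rw [mul_zero, show (1 - 0 : ℝ) / (1 / 3) - 2 = 1 by norm_num] at h1
      exact h1
    refine tendsto_of_tendsto_of_tendsto_of_le_of_le' hlow tendsto_const_nhds ?_ ?_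
    · filter_upwards [hpos, self_mem_nhdsWithin, hxlim.eventually_const_lt
        (show (0 : ℝ) < 1 / 3 by norm_num)] with x hx hx' hx0
      have hx3 := three_mul_lt_one hx'
      obtain ⟨C, hC⟩ := exists_mul_one_add_le hx3
      have hg := green_eq hS' hC (t := fun _ => (x : ℝ)) (fun _ => by simp) f b
      have h2 : q f x - (if f = b then 1 else 0) * (green S (fun _ => (x : ℝ)) b b)⁻¹ =
          x * ∑ h ∈ S f, q h x := by
        simp only [hq, ← Finset.sum_div]
        rw [hg]
        field_simp
        ring
      rw [h2, mul_div_cancel_left₀ _ hx0.ne', ← Finset.add_sum_erase _ _ hh]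
      have h3 : ∑ h' ∈ (S f).erase h, q h' x ≤ ((S f).erase h).card • (1 : ℝ) := by
        refine Finset.sum_le_card_nsmul _ _ _ fun h' _ => ?_
        exact div_le_one_of_le₀ (green_le_green_self hS' hx3 h' b) hx.le
      rw [Finset.card_erase_of_mem hh, hS] at h3
      norm_num at h3
      linarith
    · filter_upwards [hpos, self_mem_nhdsWithin] with x hx hx'
      exact div_le_one_of_le₀ (green_le_green_self hS' (three_mul_lt_one hx') h b) hx.le
  have key : ∀ (n : ℕ) f, Tendsto (q f) (𝓝[<] (1 / 3)) (𝓝 1) → 0 < walkCount S n f a →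
      Tendsto (q a) (𝓝[<] (1 / 3)) (𝓝 1) := by
    intro n
    induction n with
    | zero =>
      intro f hf h0
      have : f = a := by
        by_contra h
        simp [walkCount, h] at h0
      rwa [← this]
    | succ n ih =>
      intro f hf h0
      rw [walkCount] at h0
      obtain ⟨h, hh, hp⟩ := Finset.sum_pos_iff.1 h0
      exact ih h (hstep f hf h hh) hp
  refine key n b ?_ hn
  refine tendsto_const_nhds.congr' ?_
  filter_upwards [hpos] with x hx
  exact (div_self hx.ne').symm

end WalkCount

/-! ### Invariance under automorphisms -/

section Automorphism

variable {D : Type*} {S : D → Finset D}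

theorem pathWeight_map_equiv (σ : D ≃ D) (hσ : ∀ f h, σ h ∈ S (σ f) ↔ h ∈ S f) {R : Type*}
    [CommSemiring R] (x : R) (f : D) (l : List D) (g : D) :
    pathWeight S (fun _ => x) (σ f) (l.map σ) (σ g) = pathWeight S (fun _ => x) f l g := by
  classical
  induction l generalizing f with
  | nil =>
    rw [List.map_nil, pathWeight, pathWeight]
    exact if_congr (hσ _ _) rfl rfl
  | cons h l ih =>
    rw [List.map_cons, pathWeight, pathWeight, ih]
    exact if_congr (hσ _ _) rfl rfl

theorem green_map_equiv (σ : D ≃ D) (hσ : ∀ f h, σ h ∈ S (σ f) ↔ h ∈ S f) {𝕜 : Type*}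
    [NormedField 𝕜] (x : 𝕜) (f g : D) :
    green S (fun _ => x) (σ f) (σ g) = green S (fun _ => x) f g := by
  classical
  rw [green, green]
  congr 1
  · exact if_congr σ.injective.eq_iff rfl rfl
  · rw [← (Equiv.listEquivOfEquiv σ).tsum_eq]
    exact tsum_congr fun l => pathWeight_map_equiv σ hσ x f l g

theorem tsum_pathWeight_map_equiv (σ : D ≃ D) (hσ : ∀ f h, σ h ∈ S (σ f) ↔ h ∈ S f)
    (x : ℝ≥0∞) (f g : D) :
    ∑' l, pathWeight S (fun _ => x) (σ f) l (σ g) = ∑' l, pathWeight S (fun _ => x) f l g := by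
  rw [← (Equiv.listEquivOfEquiv σ).tsum_eq]
  exact tsum_congr fun l => pathWeight_map_equiv σ hσ x f l g

end Automorphism

/-! ### The square lattice and the torus -/

section Lattice

variable (R : Type) [CommRing R]

/-- The non-backtracking successors of a directed edge of the square lattice over `R`. -/
noncomputable def latticeSucc (f : (Fin 2 → R) × Fin 2 × ℤˣ) :
    Finset ((Fin 2 → R) × Fin 2 × ℤˣ) :=
  (Finset.univ.filter fun d : Fin 2 × ℤˣ => d ≠ (f.2.1, -f.2.2)).map
    ⟨fun d => ((hypercubicGraph R 2).head f, d), Prod.mk_right_injective _⟩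

variable {R}

theorem mem_latticeSucc (f h : (Fin 2 → R) × Fin 2 × ℤˣ) :
    h ∈ latticeSucc R f ↔ (hypercubicGraph R 2).Step f h := by
  obtain ⟨k, d⟩ := h
  simp only [latticeSucc, Finset.mem_map, Finset.mem_filter, Finset.mem_univ, true_and,
    Function.Embedding.coeFn_mk, SerreGraph.Step]
  constructor
  · rintro ⟨d', hd', h⟩
    obtain ⟨rfl, rfl⟩ := Prod.mk.inj h
    exact ⟨rfl, fun h' => hd' (Prod.mk.inj h').2⟩
  · rintro ⟨rfl, h⟩
    exact ⟨d, fun hd => h (Prod.ext rfl hd), rfl⟩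

theorem card_latticeSucc (f : (Fin 2 → R) × Fin 2 × ℤˣ) : (latticeSucc R f).card = 3 := by
  rw [latticeSucc, Finset.card_map]
  generalize (f.2.1, -f.2.2) = d
  revert d
  decide

theorem sum_latticeSucc {M : Type*} [AddCommMonoid M] (f : (Fin 2 → R) × Fin 2 × ℤˣ)
    (F : (Fin 2 → R) × Fin 2 × ℤˣ → M) :
    ∑ h ∈ latticeSucc R f, F h =
      ∑ d ∈ Finset.univ.filter fun d : Fin 2 × ℤˣ => d ≠ (f.2.1, -f.2.2),
        F ((hypercubicGraph R 2).head f, d) := by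
  rw [latticeSucc, Finset.sum_map]
  rfl

/-- The point reflection of the square lattice which maps the vertex `k` to `c - k`. -/
def latticeReflection (c : Fin 2 → R) :
    (Fin 2 → R) × Fin 2 × ℤˣ ≃ (Fin 2 → R) × Fin 2 × ℤˣ where
  toFun f := (c - f.1, f.2.1, -f.2.2)
  invFun f := (c - f.1, f.2.1, -f.2.2)
  left_inv f := by simp
  right_inv f := by simp

theorem latticeReflection_mem_latticeSucc (c : Fin 2 → R) (f h : (Fin 2 → R) × Fin 2 × ℤˣ) :
    latticeReflection c h ∈ latticeSucc R (latticeReflection c f) ↔ h ∈ latticeSucc R f := by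
  obtain ⟨k, j, ε⟩ := f
  obtain ⟨k', j', ε'⟩ := h
  rw [mem_latticeSucc, mem_latticeSucc]
  simp only [SerreGraph.Step, hypercubicGraph, latticeReflection, Equiv.coe_fn_mk, Units.val_neg,
    Int.cast_neg, Pi.single_neg, ne_eq, Prod.mk.injEq, neg_inj]
  have h1 : c - k' = c - k + -Pi.single j ((ε : ℤ) : R) ↔ k' = k + Pi.single j ((ε : ℤ) : R) := by
    constructor
    · intro h
      have := congrArg (fun v => c - v) h
      simp only [sub_sub_cancel] at this
      rw [this]
      abel
    · rintro rfl
      abel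
  rw [h1]

/-- With the sum of the two endpoints as `c`, the reflection is the one in the midpoint of the edge.
It supplies the symmetry between `a` and its reversal needed to decouple the perturbation. -/
theorem latticeReflection_self (a : (Fin 2 → R) × Fin 2 × ℤˣ) :
    latticeReflection (a.1 + (hypercubicGraph R 2).head a) a = (hypercubicGraph R 2).rev a := by
  simp [latticeReflection, hypercubicGraph]

theorem latticeReflection_rev (a : (Fin 2 → R) × Fin 2 × ℤˣ) :
    latticeReflection (a.1 + (hypercubicGraph R 2).head a) ((hypercubicGraph R 2).rev a) = a := by
  simp [latticeReflection, hypercubicGraph]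

theorem walkCount_rev_latticeSucc (n : ℕ) (f g : (Fin 2 → R) × Fin 2 × ℤˣ) :
    walkCount (latticeSucc R) n ((hypercubicGraph R 2).rev g) ((hypercubicGraph R 2).rev f) =
      walkCount (latticeSucc R) n f g := by
  refine walkCount_rev _ (hypercubicGraph R 2).rev_rev (fun f g h => ?_) n f g
  rw [mem_latticeSucc] at h ⊢
  exact (hypercubicGraph R 2).step_rev h

/-- A directed edge is connected to its reversal by the walk which goes around a unit square. -/
theorem walkCount_five_rev_pos (g : (Fin 2 → R) × Fin 2 × ℤˣ) :
    0 < walkCount (latticeSucc R) 5 g ((hypercubicGraph R 2).rev g) := by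
  obtain ⟨k, j, ε⟩ := g
  have hj : 1 - j ≠ j := by revert j; decide
  have hj' : j ≠ 1 - j := hj.symm
  have hε : ε ≠ -ε := by revert ε; decide
  set u : Fin 2 → R := Pi.single j ((ε : ℤ) : R) with hu
  set w : Fin 2 → R := Pi.single (1 - j) (1 : R) with hw
  -- Backtracking is excluded by the direction labels alone, so vertices may coincide, as on the
  -- tori with $n=1,2$.
  have h1 : (k + u, j, ε) ∈ latticeSucc R (k, j, ε) := by
    rw [mem_latticeSucc]
    exact ⟨rfl, fun h => hε (Prod.mk.inj (Prod.mk.inj h).2).2⟩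
  have h2 : (k + u + u, 1 - j, 1) ∈ latticeSucc R (k + u, j, ε) := by
    rw [mem_latticeSucc]
    exact ⟨rfl, fun h => hj (Prod.mk.inj (Prod.mk.inj h).2).1⟩
  have h3 : (k + u + u + w, j, -ε) ∈ latticeSucc R (k + u + u, 1 - j, 1) := by
    rw [mem_latticeSucc]
    refine ⟨?_, fun h => hj' (Prod.mk.inj (Prod.mk.inj h).2).1⟩
    simp [hypercubicGraph, hw]
  have h4 : (k + u + w, 1 - j, -1) ∈ latticeSucc R (k + u + u + w, j, -ε) := by
    rw [mem_latticeSucc]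
    refine ⟨?_, fun h => hj (Prod.mk.inj (Prod.mk.inj h).2).1⟩
    simp only [hypercubicGraph, Units.val_neg, Int.cast_neg, Pi.single_neg, ← hu]
    abel
  have h5 : (k + u, j, -ε) ∈ latticeSucc R (k + u + w, 1 - j, -1) := by
    rw [mem_latticeSucc]
    refine ⟨?_, fun h => hj' (Prod.mk.inj (Prod.mk.inj h).2).1⟩
    simp [hypercubicGraph, hw, Pi.single_neg]
  exact walkCount_pos_succ _ h1 <| walkCount_pos_succ _ h2 <| walkCount_pos_succ _ h3 <|
    walkCount_pos_succ _ h4 <| walkCount_pos_succ _ h5 <| walkCount_self_zero _ _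

/-- The projection of the square lattice over `ℤ` to the one over `R` which maps the vertex `0`
to `k₀`. -/
def latticeProj (k₀ : Fin 2 → R) (f : (Fin 2 → ℤ) × Fin 2 × ℤˣ) : (Fin 2 → R) × Fin 2 × ℤˣ :=
  (fun i => k₀ i + (f.1 i : R), f.2)

theorem head_latticeProj (k₀ : Fin 2 → R) (f : (Fin 2 → ℤ) × Fin 2 × ℤˣ) (d : Fin 2 × ℤˣ) :
    ((hypercubicGraph R 2).head (latticeProj k₀ f), d) =
      latticeProj k₀ ((hypercubicGraph ℤ 2).head f, d) := by
  simp only [latticeProj, hypercubicGraph, Prod.mk.injEq, and_true]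
  funext i
  simp only [Pi.add_apply, Pi.single_apply]
  split_ifs <;> simp [add_assoc]

/-- The projection keeps direction labels, so successors correspond bijectively and distinct walks
from `f` have distinct images. -/
theorem walkCount_le_walkCount_latticeProj (k₀ : Fin 2 → R) (n : ℕ)
    (f g : (Fin 2 → ℤ) × Fin 2 × ℤˣ) :
    walkCount (latticeSucc ℤ) n f g ≤
      walkCount (latticeSucc R) n (latticeProj k₀ f) (latticeProj k₀ g) := by
  induction n generalizing f with
  | zero =>
    simp only [walkCount]
    by_cases h : f = g
    · simp [h]
    · simp [h]
  | succ n ih =>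
    rw [walkCount, walkCount, sum_latticeSucc, sum_latticeSucc]
    refine Finset.sum_le_sum fun d _ => ?_
    rw [head_latticeProj]
    exact ih _

end Lattice

/-! ### Recurrence of the non-backtracking walk -/

section Recurrence

/-- A function of the state of the non-backtracking walk on `ℤ²`, comparable to the square of the
distance from the origin, whose expectation grows by `2` in every step. -/
def latticeEnergy (f : (Fin 2 → ℤ) × Fin 2 × ℤˣ) : ℤ :=
  f.1 0 ^ 2 + f.1 1 ^ 2 + 3 * (f.2.2 : ℤ) * f.1 f.2.1 + 3

/-- The difference of the two sides is a sum of squares, one of them $(k_j+3\varepsilon)^2$. -/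
theorem le_two_mul_latticeEnergy (f : (Fin 2 → ℤ) × Fin 2 × ℤˣ) (i : Fin 2) :
    f.1 i ^ 2 - 3 ≤ 2 * latticeEnergy f := by
  obtain ⟨k, j, ε⟩ := f
  simp only [latticeEnergy]
  rcases Int.units_eq_one_or ε with rfl | rfl <;> fin_cases i <;> fin_cases j <;>
    simp only [Fin.zero_eta, Fin.mk_one, Units.val_one, Units.val_neg] <;>
    nlinarith [sq_nonneg (k 0 + 3), sq_nonneg (k 0 - 3), sq_nonneg (k 1 + 3), sq_nonneg (k 1 - 3),
      sq_nonneg (k 0), sq_nonneg (k 1)]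

theorem latticeEnergy_nonneg (f : (Fin 2 → ℤ) × Fin 2 × ℤˣ) : 0 ≤ latticeEnergy f := by
  obtain ⟨k, j, ε⟩ := f
  simp only [latticeEnergy]
  rcases Int.units_eq_one_or ε with rfl | rfl <;> fin_cases j <;>
    simp only [Fin.zero_eta, Fin.mk_one, Units.val_one, Units.val_neg] <;>
    nlinarith [sq_nonneg (2 * k 0 + 3), sq_nonneg (2 * k 0 - 3), sq_nonneg (2 * k 1 + 3),
      sq_nonneg (2 * k 1 - 3), sq_nonneg (k 0), sq_nonneg (k 1)]

/-- With $v=\varepsilon e_j$ the energy is $|k|^2+3v\cdot k+3$. The successors start at $k+v$ and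
their directions sum to $v$, so the left side is $3|k+v|^2+3v\cdot(k+v)+9$. The coefficient 3 of
$v\cdot k$ is the one for which the linear terms agree. -/
theorem sum_latticeEnergy (f : (Fin 2 → ℤ) × Fin 2 × ℤˣ) :
    ∑ h ∈ latticeSucc ℤ f, latticeEnergy h = 3 * (latticeEnergy f + 2) := by
  have huniv : ∀ G : ℤˣ → ℤ, ∑ ε, G ε = G 1 + G (-1) := fun G => by
    rw [show (Finset.univ : Finset ℤˣ) = {1, -1} from rfl, Finset.sum_pair (by decide)]
  rw [sum_latticeSucc, Finset.sum_filter, Fintype.sum_prod_type, Fin.sum_univ_two, huniv, huniv]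
  obtain ⟨k, j, ε⟩ := f
  rcases Int.units_eq_one_or ε with rfl | rfl <;> fin_cases j <;>
    simp [latticeEnergy, hypercubicGraph, show (-1 : ℤˣ) ≠ 1 by decide,
      show (1 : ℤˣ) ≠ -1 by decide] <;> ring

theorem tsum_walkCount_mul_latticeEnergy (m : ℕ) (f : (Fin 2 → ℤ) × Fin 2 × ℤˣ) :
    ∑' g, (walkCount (latticeSucc ℤ) m f g : ℝ≥0∞) * ((latticeEnergy g).toNat : ℝ≥0∞) =
      3 ^ m * ((latticeEnergy f).toNat + m * 2) := by
  refine tsum_walkCount_mul_eq _ (c := 2) card_latticeSucc (fun f => ?_) m f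
  have h : ∑ h ∈ latticeSucc ℤ f, (latticeEnergy h).toNat = 3 * ((latticeEnergy f).toNat + 2) := by
    zify
    simp only [Int.toNat_of_nonneg (latticeEnergy_nonneg _)]
    exact sum_latticeEnergy f
  exact_mod_cast h

/-- The directed edges of `ℤ²` with tail in the box `[-r, r]²`. -/
noncomputable def latticeBox (r : ℕ) : Finset ((Fin 2 → ℤ) × Fin 2 × ℤˣ) :=
  (Fintype.piFinset fun _ => Finset.Icc (-r : ℤ) r) ×ˢ Finset.univ

theorem card_latticeBox (r : ℕ) : (latticeBox r).card = (2 * r + 1) ^ 2 * 4 := by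
  have h : (Finset.univ : Finset (Fin 2 × ℤˣ)).card = 4 := by decide
  rw [latticeBox, Finset.card_product, h, Fintype.card_piFinset]
  simp only [Int.card_Icc, Finset.prod_const, Finset.card_univ, Fintype.card_fin]
  congr 2
  omega

theorem le_latticeEnergy_of_notMem_latticeBox {m : ℕ} {g : (Fin 2 → ℤ) × Fin 2 × ℤˣ}
    (hg : g ∉ latticeBox (Nat.sqrt (8 * m + 15))) : 4 * m + 6 ≤ (latticeEnergy g).toNat := by
  simp only [latticeBox, Finset.mem_product, Finset.mem_univ, and_true, Fintype.mem_piFinset,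
    Finset.mem_Icc, not_forall, ← abs_le, not_le] at hg
  obtain ⟨i, hi⟩ := hg
  have h1 : 8 * m + 15 < (g.1 i).natAbs ^ 2 := by
    rw [← Nat.sqrt_lt']
    zify
    exact hi
  have h2 := le_two_mul_latticeEnergy g i
  have h3 : ((8 * m + 15 : ℕ) : ℤ) < g.1 i ^ 2 := by
    rw [← Int.natAbs_sq]
    exact_mod_cast h1
  push_cast at h3
  omega

/-- Markov's inequality: the mean energy after `m` steps is $2m+3$, while outside the box it is at
least $4m+6$. So at most half of the $3^m$ walks end outside. -/
theorem pow_le_two_mul_sum_walkCount (m : ℕ) (d : Fin 2 × ℤˣ) :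
    3 ^ m ≤ 2 * ∑ g ∈ latticeBox (Nat.sqrt (8 * m + 15)), walkCount (latticeSucc ℤ) m (0, d) g := by
  classical
  set B := latticeBox (Nat.sqrt (8 * m + 15)) with hB
  have h1 : ∑' g, (walkCount (latticeSucc ℤ) m (0, d) g : ℝ≥0∞) * ((4 * m + 6 : ℕ) : ℝ≥0∞) =
      3 ^ m * ((4 * m + 6 : ℕ) : ℝ≥0∞) := by
    rw [tsum_walkCount_mul_eq _ (c := 0) card_latticeSucc]
    · simp
    · intro f
      rw [Finset.sum_const, card_latticeSucc, nsmul_eq_mul]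
      simp
  have h2 : ∑' g, (walkCount (latticeSucc ℤ) m (0, d) g : ℝ≥0∞) * ((4 * m + 6 : ℕ) : ℝ≥0∞) ≤
      ∑' g, ((if g ∈ B then (walkCount (latticeSucc ℤ) m (0, d) g : ℝ≥0∞) *
        ((4 * m + 6 : ℕ) : ℝ≥0∞) else 0) +
      (walkCount (latticeSucc ℤ) m (0, d) g : ℝ≥0∞) * ((latticeEnergy g).toNat : ℝ≥0∞)) := by
    refine ENNReal.tsum_le_tsum fun g => ?_
    by_cases hg : g ∈ B
    · rw [if_pos hg]
      exact le_self_add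
    · rw [if_neg hg, zero_add]
      gcongr
      exact le_latticeEnergy_of_notMem_latticeBox hg
  rw [h1, ENNReal.tsum_add, tsum_walkCount_mul_latticeEnergy,
    tsum_eq_sum (s := B) (fun g hg => if_neg hg), Finset.sum_congr rfl fun g hg => if_pos hg,
    ← Finset.sum_mul] at h2
  have h3 : latticeEnergy (0, d) = 3 := by simp [latticeEnergy]
  rw [h3] at h2
  have h4 : 3 ^ m * (4 * m + 6) ≤ (∑ g ∈ B, walkCount (latticeSucc ℤ) m (0, d) g) * (4 * m + 6) +
      3 ^ m * (3 + m * 2) := by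
    exact_mod_cast h2
  have h5 : 3 ^ m * (2 * m + 3) ≤
      (2 * ∑ g ∈ B, walkCount (latticeSucc ℤ) m (0, d) g) * (2 * m + 3) := by
    linarith
  exact Nat.le_of_mul_le_mul_right h5 (by omega)

/-- Walk from $\vec e$ to $g$ in $m$ steps, turn $g$ around in five, and return by a reversed
$m$-step walk ending at $-\vec e$. Summed over $g$ in the box this gives at least the sum of squared
counts, bounded below by Cauchy–Schwarz; the box has $O(m+1)$ elements. -/
theorem pow_le_mul_walkCount_rev (m : ℕ) (d : Fin 2 × ℤˣ) :
    9 ^ m ≤ 2160 * (m + 1) *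
      walkCount (latticeSucc ℤ) (m + (5 + m)) (0, d) ((hypercubicGraph ℤ 2).rev (0, d)) := by
  set e : (Fin 2 → ℤ) × Fin 2 × ℤˣ := (0, d) with he
  set r := Nat.sqrt (8 * m + 15) with hr
  set W := walkCount (latticeSucc ℤ) (m + (5 + m)) e ((hypercubicGraph ℤ 2).rev e) with hW
  have h1 : ∑ g ∈ latticeBox r, walkCount (latticeSucc ℤ) m e g ^ 2 ≤ W := by
    refine le_trans (Finset.sum_le_sum fun g _ => ?_)
      (sum_walkCount_mul_le (latticeSucc ℤ) m (5 + m) e ((hypercubicGraph ℤ 2).rev e) _)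
    rw [sq]
    refine Nat.mul_le_mul_left _ ?_
    refine le_trans ?_ (walkCount_mul_le _ 5 m g ((hypercubicGraph ℤ 2).rev g) _)
    rw [walkCount_rev_latticeSucc]
    exact Nat.le_mul_of_pos_left _ (walkCount_five_rev_pos g)
  have h2 := sq_sum_le_card_mul_sum_sq (s := latticeBox r) (f := walkCount (latticeSucc ℤ) m e)
  have h3 := pow_le_two_mul_sum_walkCount m d
  rw [card_latticeBox] at h2
  -- $(2r+1)^2\le 9r^2\le 9(8m+15)$. The final constant is $2160=4\cdot4\cdot135$.
  have h4 : (2 * r + 1) ^ 2 ≤ 135 * (m + 1) := by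
    have h5 : r ^ 2 ≤ 8 * m + 15 := Nat.sqrt_le' _
    have h6 : 1 ≤ r := Nat.sqrt_pos.2 (by omega)
    nlinarith
  set s := ∑ g ∈ latticeBox r, walkCount (latticeSucc ℤ) m e g with hs
  calc 9 ^ m = (3 ^ m) ^ 2 := by rw [← pow_mul, mul_comm, pow_mul]; norm_num
    _ ≤ (2 * s) ^ 2 := Nat.pow_le_pow_left h3 2
    _ = 4 * s ^ 2 := by ring
    _ ≤ 4 * ((135 * (m + 1) * 4) * W) := by
        refine Nat.mul_le_mul_left _ (h2.trans ?_)
        exact Nat.mul_le_mul (Nat.mul_le_mul_right _ h4) h1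
    _ = _ := by ring

/-- The terms of index $2m+5$ alone dominate a multiple of the harmonic series; $243=3^5$. -/
theorem tendsto_sum_walkCount_int (d : Fin 2 × ℤˣ) :
    Tendsto (fun N => ∑ n ∈ Finset.range N, (1 / 3 : ℝ) ^ n *
      walkCount (latticeSucc ℤ) n (0, d) ((hypercubicGraph ℤ 2).rev (0, d))) atTop atTop := by
  rw [← not_summable_iff_tendsto_nat_atTop_of_nonneg fun n => by positivity]
  intro h
  have h1 := h.comp_injective (i := fun m : ℕ => m + (5 + m)) fun a b hab => by
    simp only at hab
    omega
  have h2 : Summable fun m : ℕ => (1 / (243 * 2160) : ℝ) * (1 / ((m + 1 : ℕ) : ℝ)) := by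
    refine Summable.of_nonneg_of_le (fun m => by positivity) (fun m => ?_) h1
    have h3 := pow_le_mul_walkCount_rev m d
    simp only [Function.comp_apply]
    set W := walkCount (latticeSucc ℤ) (m + (5 + m)) (0, d) ((hypercubicGraph ℤ 2).rev (0, d))
    have h4 : (9 : ℝ) ^ m ≤ 2160 * (m + 1) * W := by exact_mod_cast h3
    have h5 : (1 / 3 : ℝ) ^ (m + (5 + m)) = 1 / (243 * 9 ^ m) := by
      rw [show m + (5 + m) = 5 + 2 * m by ring, pow_add, pow_mul, one_div_pow, one_div_pow,
        one_div_pow, one_div_mul_one_div]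
      norm_num
    rw [h5, one_div_mul_one_div, one_div_mul_eq_div, div_le_div_iff₀ (by positivity) (by positivity)]
    push_cast
    nlinarith
  rw [summable_mul_left_iff (by norm_num)] at h2
  exact Real.not_summable_one_div_natCast ((summable_nat_add_iff 1).1 h2)

variable {R : Type} [CommRing R]

theorem tendsto_sum_walkCount_rev (a : (Fin 2 → R) × Fin 2 × ℤˣ) :
    Tendsto (fun N => ∑ n ∈ Finset.range N, (1 / 3 : ℝ) ^ n *
      walkCount (latticeSucc R) n a ((hypercubicGraph R 2).rev a)) atTop atTop := by
  refine tendsto_atTop_mono (fun N => Finset.sum_le_sum fun n _ => ?_)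
    (tendsto_sum_walkCount_int a.2)
  refine mul_le_mul_of_nonneg_left ?_ (by positivity)
  have h := walkCount_le_walkCount_latticeProj a.1 n (0, a.2) ((hypercubicGraph ℤ 2).rev (0, a.2))
  have h1 : latticeProj a.1 (0, a.2) = a := by simp [latticeProj]
  have h2 : latticeProj a.1 ((hypercubicGraph ℤ 2).rev (0, a.2)) = (hypercubicGraph R 2).rev a := by
    have := head_latticeProj a.1 (0, a.2) (a.2.1, -a.2.2)
    rw [h1] at this
    exact this.symm
  rw [h1, h2] at h
  exact_mod_cast h

end Recurrence

/-! ### The limit law and convergence of characteristic functions -/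

theorem charFun_map_sq_gaussianReal (θ : ℝ) :
    charFun ((gaussianReal 0 1).map fun y : ℝ => y ^ 2) θ =
      Complex.exp (-(1 / 2 : ℂ) * Complex.log (1 - 2 * θ * Complex.I)) := by
  rw [charFun_apply_real, integral_map (by fun_prop) (by fun_prop),
    integral_gaussianReal_eq_integral_smul one_ne_zero]
  have hb : 0 < ((1 / 2 : ℂ) - θ * Complex.I).re := by simp
  have hw : (1 - 2 * θ * Complex.I : ℂ) ≠ 0 := by
    intro h
    have := congrArg Complex.re h
    simp at this
  have h1 : ∀ y : ℝ, gaussianPDFReal 0 1 y • Complex.exp (θ * ((y ^ 2 : ℝ) : ℂ) * Complex.I) =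
      ((√(2 * Real.pi))⁻¹ : ℝ) * Complex.exp (-((1 / 2 : ℂ) - θ * Complex.I) * (y : ℂ) ^ 2) := by
    intro y
    rw [gaussianPDFReal_def]
    simp only [NNReal.coe_one, mul_one, sub_zero, Complex.real_smul]
    rw [Complex.ofReal_mul, Complex.ofReal_exp, mul_assoc, ← Complex.exp_add]
    congr 2
    push_cast
    ring
  rw [integral_congr_ae (ae_of_all _ h1), integral_const_mul, integral_gaussian_complex hb]
  have h2 : (Real.pi : ℂ) / ((1 / 2 : ℂ) - θ * Complex.I) =
      ((2 * Real.pi : ℝ) : ℂ) * (1 - 2 * θ * Complex.I)⁻¹ := by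
    have h3 : (1 / 2 : ℂ) - θ * Complex.I = (1 - 2 * θ * Complex.I) / 2 := by ring
    rw [h3]
    push_cast
    field_simp
  have hpi : 0 < 2 * Real.pi := by positivity
  have harg : (1 - 2 * θ * Complex.I : ℂ).arg ≠ Real.pi := by
    intro h
    have := (Complex.arg_eq_pi_iff.1 h).1
    simp at this
    linarith
  rw [h2, Complex.cpow_def_of_ne_zero (mul_ne_zero (by exact_mod_cast hpi.ne') (inv_ne_zero hw)),
    Complex.log_ofReal_mul hpi (inv_ne_zero hw), Complex.log_inv _ harg, add_mul, Complex.exp_add]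
  have h4 : Complex.exp ((Real.log (2 * Real.pi) : ℂ) * (1 / 2)) = ((√(2 * Real.pi) : ℝ) : ℂ) := by
    have h5 : ((Real.log (2 * Real.pi) : ℂ) * (1 / 2)) =
        ((Real.log (2 * Real.pi) * (1 / 2) : ℝ) : ℂ) := by push_cast; rfl
    rw [h5, ← Complex.ofReal_exp, ← Real.rpow_def_of_pos hpi, Real.sqrt_eq_rpow]
  rw [h4, ← mul_assoc, ← Complex.ofReal_mul, inv_mul_cancel₀ (Real.sqrt_pos.2 hpi).ne',
    Complex.ofReal_one, one_mul]
  congr 1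
  ring

/-- The difference quotient at $0$ of $t\mapsto e^{it\theta}$ with increment $1/m$. -/
theorem tendsto_exp_sub_one_mul {α : Type*} {l : Filter α} {m : α → ℝ} (hm : Tendsto m l atTop)
    (θ : ℝ) : Tendsto (fun x => (Complex.exp (((θ / m x : ℝ) : ℂ) * Complex.I) - 1) * m x) l
      (𝓝 (θ * Complex.I)) := by
  have h1 : HasDerivAt (fun t : ℝ => Complex.exp (t * (θ * Complex.I))) (θ * Complex.I) 0 := by
    have h2 : HasDerivAt (fun t : ℝ => (t : ℂ) * (θ * Complex.I)) (1 * (θ * Complex.I)) 0 :=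
      HasDerivAt.mul_const Complex.ofRealCLM.hasDerivAt _
    have h3 := h2.cexp
    simpa using h3
  have h4 : Tendsto (fun x => (m x)⁻¹) l (𝓝[≠] 0) := by
    refine tendsto_nhdsWithin_iff.2 ⟨hm.inv_tendsto_atTop, ?_⟩
    filter_upwards [hm.eventually_gt_atTop 0] with x hx
    exact inv_ne_zero hx.ne'
  have h5 := h1.tendsto_slope_zero.comp h4
  refine h5.congr fun x => ?_
  simp only [Function.comp_apply, inv_inv, zero_add, Complex.ofReal_zero, zero_mul, Complex.exp_zero,
    Complex.real_smul]
  rw [mul_comm]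
  congr 3
  push_cast
  ring

/-- Lévy's continuity theorem, carried from sequences to countably generated filters. -/
theorem tendstoInDistribution_of_tendsto_charFun {α : Type*} {l : Filter α} [l.IsCountablyGenerated]
    {Ω : α → Type*} {Ω' : Type*} {mΩ : ∀ x, MeasurableSpace (Ω x)} {mΩ' : MeasurableSpace Ω'}
    {X : (x : α) → Ω x → ℝ} {Z : Ω' → ℝ} {μ : (x : α) → Measure (Ω x)}
    [∀ x, IsProbabilityMeasure (μ x)] {μ' : Measure Ω'} [IsProbabilityMeasure μ']
    (hX : ∀ x, AEMeasurable (X x) (μ x)) (hZ : AEMeasurable Z μ')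
    (h : ∀ θ, Tendsto (fun x => charFun ((μ x).map (X x)) θ) l (𝓝 (charFun (μ'.map Z) θ))) :
    TendstoInDistribution X l Z μ μ' where
  forall_aemeasurable := hX
  aemeasurable_limit := hZ
  tendsto := by
    refine tendsto_of_seq_tendsto fun u hu => ?_
    exact ProbabilityMeasure.tendsto_of_tendsto_charFun fun θ => (h θ).comp hu

/-! ### Closed form on the square lattice and the limit -/

section SquareLattice

variable {R : Type} [CommRing R]

theorem latticeGreen_rev_rev (x : ℝ) (a : (Fin 2 → R) × Fin 2 × ℤˣ) :
    green (latticeSucc R) (fun _ => x) ((hypercubicGraph R 2).rev a)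
      ((hypercubicGraph R 2).rev a) = green (latticeSucc R) (fun _ => x) a a := by
  have h := green_map_equiv (latticeReflection (a.1 + (hypercubicGraph R 2).head a))
    (latticeReflection_mem_latticeSucc _) x a a
  rwa [latticeReflection_self] at h

theorem latticeGreen_rev_self (x : ℝ) (a : (Fin 2 → R) × Fin 2 × ℤˣ) :
    green (latticeSucc R) (fun _ => x) ((hypercubicGraph R 2).rev a) a =
      green (latticeSucc R) (fun _ => x) a ((hypercubicGraph R 2).rev a) := by
  have h := green_map_equiv (latticeReflection (a.1 + (hypercubicGraph R 2).head a))
    (latticeReflection_mem_latticeSucc _) x a ((hypercubicGraph R 2).rev a)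
  rwa [latticeReflection_self, latticeReflection_rev] at h

/-- By reflection both orientations of the root contribute equally, cancelling the factor 2; the
$-1$ removes the diagonal term of the Green function. -/
theorem meanOccupation_lattice [Countable R] {x : ℝ≥0} (hx : 3 * x < 1)
    (a : (Fin 2 → R) × Fin 2 × ℤˣ) :
    (hypercubicGraph R 2).meanOccupation (fun _ => x) ((hypercubicGraph R 2).toEdge a) =
      ENNReal.ofReal (green (latticeSucc R) (fun _ => (x : ℝ)) a a - 1) := by
  have hcard : ∀ f, (latticeSucc R f).card ≤ 3 := fun f => (card_latticeSucc f).le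
  obtain ⟨C, hC⟩ := exists_mul_one_add_le hx
  have h1 := (hypercubicGraph R 2).two_mul_meanOccupation mem_latticeSucc x a
  have h2 := tsum_pathWeight_map_equiv (latticeReflection (a.1 + (hypercubicGraph R 2).head a))
    (latticeReflection_mem_latticeSucc _) (x : ℝ≥0∞) a a
  rw [latticeReflection_self] at h2
  rw [h2, ← two_mul] at h1
  rw [(ENNReal.mul_right_inj two_ne_zero ENNReal.ofNat_ne_top).1 h1]
  have h3 := summable_pathWeight_const hcard hC a a
  have h4 : ∀ l, pathWeight (latticeSucc R) (fun _ => (x : ℝ≥0∞)) a l a =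
      ((pathWeight (latticeSucc R) (fun _ => x) a l a : ℝ≥0) : ℝ≥0∞) := fun l =>
    (map_pathWeight _ ENNReal.ofNNRealHom (fun _ => x) a l a).symm
  have h5 : ∀ l, pathWeight (latticeSucc R) (fun _ => (x : ℝ)) a l a =
      ((pathWeight (latticeSucc R) (fun _ => x) a l a : ℝ≥0) : ℝ) := fun l =>
    (map_pathWeight _ NNReal.toRealHom (fun _ => x) a l a).symm
  rw [green, if_pos rfl, add_sub_cancel_left, tsum_congr h4, tsum_congr h5, ← ENNReal.coe_tsum h3,
    ← NNReal.coe_tsum, ENNReal.ofReal_coe_nnreal]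

theorem one_lt_latticeGreen {x : ℝ≥0} (hx : 3 * x < 1) (hx0 : 0 < x)
    (a : (Fin 2 → R) × Fin 2 × ℤˣ) : 1 < green (latticeSucc R) (fun _ => (x : ℝ)) a a := by
  -- Eleven terms reach length ten: turning `a` around twice, in five steps each time, gives a
  -- closed walk.
  have h1 := sum_pow_mul_walkCount_le_green (fun f => (card_latticeSucc (R := R) f).le) hx 11 a a
  have h2 : 0 < walkCount (latticeSucc R) 10 a a := by
    refine lt_of_lt_of_le (Nat.mul_pos (walkCount_five_rev_pos a) ?_)
      (walkCount_mul_le _ 5 5 a ((hypercubicGraph R 2).rev a) a)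
    have := walkCount_five_rev_pos ((hypercubicGraph R 2).rev a)
    rwa [(hypercubicGraph R 2).rev_rev] at this
  rw [Finset.sum_range_succ, Finset.sum_range_succ'] at h1
  have h3 : 0 ≤ ∑ k ∈ Finset.range 9, (x : ℝ) ^ (k + 1) * walkCount (latticeSucc R) (k + 1) a a :=
    Finset.sum_nonneg fun k _ => by positivity
  have h4 : (0 : ℝ) < (x : ℝ) ^ 10 * walkCount (latticeSucc R) 10 a a :=
    mul_pos (pow_pos (by exact_mod_cast hx0) _) (by exact_mod_cast h2)
  have h5 : walkCount (latticeSucc R) 0 a a = 1 := by simp [walkCount]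
  rw [h5, pow_zero, Nat.cast_one, mul_one] at h1
  linarith

theorem SerreGraph.measurable_normalizedOccupation {V D : Type*} [Countable D]
    (G : SerreGraph V D) (x : G.Edge → ℝ≥0) (e : G.Edge) :
    Measurable (G.normalizedOccupation x e) :=
  ((Measurable.tsum fun ℓ => measurable_natCast_apply_mul ℓ _).div_const _).ennreal_toReal

theorem charFun_normalizedOccupation_lattice [Countable R] {x : ℝ≥0} (hx : 3 * x < 1)
    (a : (Fin 2 → R) × Fin 2 × ℤˣ) {A B : ℝ} (hA : green (latticeSucc R) (fun _ => (x : ℝ)) a a = A)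
    (hB : green (latticeSucc R) (fun _ => (x : ℝ)) a ((hypercubicGraph R 2).rev a) = B)
    (hA1 : 1 ≤ A)
    (θ : ℝ) {z : ℂ} (hz : z = Complex.exp (((θ / (A - 1) : ℝ) : ℂ) * Complex.I))
    (hz' : ‖z - 1‖ < 1) :
    charFun (((hypercubicGraph R 2).soupLaw fun _ => x).map
      ((hypercubicGraph R 2).normalizedOccupation (fun _ => x) ((hypercubicGraph R 2).toEdge a))) θ =
      Complex.exp (-(1 / 2 : ℂ) * (Complex.log (1 - (z - 1) * ((A + B - 1 : ℝ) : ℂ)) +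
        Complex.log (1 - (z - 1) * ((A - B - 1 : ℝ) : ℂ)))) := by
  set G := hypercubicGraph R 2 with hG
  have hcard : ∀ f, (latticeSucc R f).card ≤ 3 := fun f => (card_latticeSucc f).le
  have hmean := meanOccupation_lattice hx a
  rw [hA, ← hG] at hmean
  have hfin : ∑' ℓ, (G.loopMeasure (fun _ => x) ℓ : ℝ≥0∞) * (G.visits (G.toEdge a) ℓ : ℝ≥0∞) ≠ ∞ := by
    rw [← G.meanOccupation_eq_tsum, hmean]
    exact ENNReal.ofReal_ne_top
  have hA' := latticeGreen_rev_rev (x : ℝ) a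
  have hB' := latticeGreen_rev_self (x : ℝ) a
  rw [hA] at hA'
  rw [hB] at hB'
  have hB0 : 0 ≤ B := hB ▸ green_nonneg hcard hx _ _
  have hBA : B ≤ A := by
    rw [← hB, ← hA']
    exact green_le_green_self hcard hx _ _
  -- $0\le B\le A$ gives the lower bounds that keep both logarithms off the cut.
  have hg : -1 ≤ A + B - 1 := by linarith
  have hh : -1 ≤ A - B - 1 := by linarith
  have hz1 : ‖z‖ ≤ 1 := by rw [hz, Complex.norm_exp_ofReal_mul_I]
  have hsum : Summable fun ℓ => (G.loopMeasure (fun _ => x) ℓ : ℝ) * G.visits (G.toEdge a) ℓ := by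
    have := ENNReal.summable_toReal hfin
    simpa using this
  have hlog := tsum_mul_pow_sub_one_eq_log (fun ℓ => (G.loopMeasure (fun _ => x) ℓ).coe_nonneg)
    hsum hg hh (fun w hw hw' => by
      have hw0 : w ≠ 0 := by
        rintro rfl
        simp at hw'
      have hne : ∀ k : ℝ, -1 ≤ k → 1 - (w - 1) * (k : ℂ) ≠ 0 := fun k hk h => by
        have := re_one_sub_mul_pos hw hw' hk
        rw [h] at this
        simp at this
      exact G.tsum_loopMeasure_mul_visits_mul_pow mem_latticeSucc hcard hx a hA hA' hB hB' hw hw0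
        (hne _ hg) (hne _ hh)) hz1 hz'
  rw [← hlog, charFun_apply_real, integral_map
    (G.measurable_normalizedOccupation _ _).aemeasurable (by fun_prop), hz]
  rw [← integral_cexp_tsum_infinitePi_poissonMeasure _ _ (θ / (A - 1)) hfin]
  refine integral_congr_ae (ae_of_all _ fun L => ?_)
  simp only [SerreGraph.normalizedOccupation, hmean, ENNReal.toReal_div,
    ENNReal.toReal_ofReal (sub_nonneg.2 hA1), SerreGraph.occupation]
  congr 2
  push_cast
  ring

theorem meanOccupation_lattice_pos_and_lt_top [Countable R] (a : (Fin 2 → R) × Fin 2 × ℤˣ)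
    {x : ℝ≥0} (hx0 : 0 < x) (hx : x < 1 / 3) :
    0 < (hypercubicGraph R 2).meanOccupation (fun _ => x) ((hypercubicGraph R 2).toEdge a) ∧
      (hypercubicGraph R 2).meanOccupation (fun _ => x) ((hypercubicGraph R 2).toEdge a) < ∞ := by
  rw [meanOccupation_lattice (three_mul_lt_one hx)]
  refine ⟨ENNReal.ofReal_pos.2 ?_, ENNReal.ofReal_lt_top⟩
  linarith [one_lt_latticeGreen (three_mul_lt_one hx) hx0 a]

theorem tendstoInDistribution_normalizedOccupation_lattice [Countable R]
    (a : (Fin 2 → R) × Fin 2 × ℤˣ) :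
    TendstoInDistribution
      (fun x : ℝ≥0 => (hypercubicGraph R 2).normalizedOccupation (fun _ => x)
        ((hypercubicGraph R 2).toEdge a))
      (𝓝[<] (1 / 3 : ℝ≥0)) (fun y : ℝ => y ^ 2)
      (fun x : ℝ≥0 => (hypercubicGraph R 2).soupLaw (fun _ => x)) (gaussianReal 0 1) := by
  refine tendstoInDistribution_of_tendsto_charFun
    (fun x => ((hypercubicGraph R 2).measurable_normalizedOccupation _ _).aemeasurable)
    (by fun_prop) fun θ => ?_
  rw [charFun_map_sq_gaussianReal]
  have hcard : ∀ f, (latticeSucc R f).card ≤ 3 := fun f => (card_latticeSucc f).le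
  set A : ℝ≥0 → ℝ := fun x => green (latticeSucc R) (fun _ => (x : ℝ)) a a with hA
  set B : ℝ≥0 → ℝ := fun x =>
    green (latticeSucc R) (fun _ => (x : ℝ)) a ((hypercubicGraph R 2).rev a) with hB
  have hBA : ∀ᶠ x in 𝓝[<] (1 / 3 : ℝ≥0), B x ≤ A x := by
    filter_upwards [self_mem_nhdsWithin] with x hx
    have := green_le_green_self hcard (three_mul_lt_one hx) a ((hypercubicGraph R 2).rev a)
    rwa [latticeGreen_rev_rev] at this
  -- Recurrence was shown for walks from `a` to its reversal, so it is `B` that diverges first; `A`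
  -- dominates it.
  have hAlim : Tendsto A (𝓝[<] (1 / 3)) atTop :=
    tendsto_atTop_mono' _ hBA (tendsto_green_atTop hcard (tendsto_sum_walkCount_rev a))
  have hratio : Tendsto (fun x => B x / A x) (𝓝[<] (1 / 3)) (𝓝 1) := by
    have h1 := tendsto_green_div_green (S := latticeSucc R) card_latticeSucc (a := a)
      (b := (hypercubicGraph R 2).rev a) (by simpa only [latticeGreen_rev_rev] using hAlim) (n := 5)
      (by simpa only [(hypercubicGraph R 2).rev_rev] using
        walkCount_five_rev_pos ((hypercubicGraph R 2).rev a))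
    simpa only [latticeGreen_rev_rev] using h1
  have hm : Tendsto (fun x => A x - 1) (𝓝[<] (1 / 3)) atTop :=
    tendsto_atTop_add_const_right _ (-1) hAlim
  have hinv : Tendsto (fun x => (A x)⁻¹) (𝓝[<] (1 / 3)) (𝓝 0) := hAlim.inv_tendsto_atTop
  have hden : Tendsto (fun x => 1 - (A x)⁻¹) (𝓝[<] (1 / 3)) (𝓝 1) := by
    simpa using hinv.const_sub 1
  have hg : Tendsto (fun x => (A x + B x - 1) / (A x - 1)) (𝓝[<] (1 / 3)) (𝓝 2) := by
    have h1 := ((hratio.const_add 1).sub hinv).div hden one_ne_zero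
    rw [show ((1 : ℝ) + 1 - 0) / 1 = 2 by norm_num] at h1
    refine h1.congr' ?_
    filter_upwards [hAlim.eventually_gt_atTop 1] with x hx
    have h2 : A x ≠ 0 := by linarith
    have h3 : A x - 1 ≠ 0 := by linarith
    simp only [Pi.div_apply]
    field_simp
  have hh : Tendsto (fun x => (A x - B x - 1) / (A x - 1)) (𝓝[<] (1 / 3)) (𝓝 0) := by
    have h1 := ((hratio.const_sub 1).sub hinv).div hden one_ne_zero
    rw [show ((1 : ℝ) - 1 - 0) / 1 = 0 by norm_num] at h1
    refine h1.congr' ?_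
    filter_upwards [hAlim.eventually_gt_atTop 1] with x hx
    have h2 : A x ≠ 0 := by linarith
    have h3 : A x - 1 ≠ 0 := by linarith
    simp only [Pi.div_apply]
    field_simp
  set z : ℝ≥0 → ℂ := fun x => Complex.exp (((θ / (A x - 1) : ℝ) : ℂ) * Complex.I) with hz
  have hzm : Tendsto (fun x => (z x - 1) * ((A x - 1 : ℝ) : ℂ)) (𝓝[<] (1 / 3))
      (𝓝 (θ * Complex.I)) := tendsto_exp_sub_one_mul hm θ
  have hz1 : Tendsto z (𝓝[<] (1 / 3)) (𝓝 1) := by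
    have h1 : Tendsto (fun x => θ / (A x - 1)) (𝓝[<] (1 / 3)) (𝓝 0) := hm.const_div_atTop θ
    have h2 : Continuous fun t : ℝ => Complex.exp ((t : ℂ) * Complex.I) := by fun_prop
    have h3 := (h2.tendsto 0).comp h1
    rw [Complex.ofReal_zero, zero_mul, Complex.exp_zero] at h3
    exact h3
  have hz1' : ∀ᶠ x in 𝓝[<] (1 / 3 : ℝ≥0), ‖z x - 1‖ < 1 := by
    have h1 := (hz1.sub_const 1).norm
    rw [sub_self, norm_zero] at h1
    exact h1.eventually_lt_const one_pos
  -- Factor $(z-1)k=(z-1)(A-1)\cdot k/(A-1)\to i\theta c$. The limit $1-i\theta c$ has real part 1,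
  -- where the logarithm is continuous.
  have hkey : ∀ {k : ℝ≥0 → ℝ} {c : ℝ}, Tendsto (fun x => k x / (A x - 1)) (𝓝[<] (1 / 3)) (𝓝 c) →
      Tendsto (fun x => Complex.log (1 - (z x - 1) * (k x : ℂ))) (𝓝[<] (1 / 3))
        (𝓝 (Complex.log (1 - θ * Complex.I * c))) := by
    intro k c hk
    have h1 := (hzm.mul ((Complex.continuous_ofReal.tendsto c).comp hk)).const_sub 1
    refine Tendsto.clog (h1.congr' ?_) ?_
    · filter_upwards [hAlim.eventually_gt_atTop 1] with x hx
      have h3 : ((A x - 1 : ℝ) : ℂ) ≠ 0 := by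
        have : A x - 1 ≠ 0 := by linarith
        exact_mod_cast this
      simp only [Function.comp_apply, Complex.ofReal_div]
      field_simp
    · left
      simp
  have hlim := (((hkey hg).add (hkey hh)).const_mul (-(1 / 2) : ℂ)).cexp
  have hval : Complex.log (1 - θ * Complex.I * ((2 : ℝ) : ℂ)) +
      Complex.log (1 - θ * Complex.I * ((0 : ℝ) : ℂ)) = Complex.log (1 - 2 * θ * Complex.I) := by
    rw [Complex.ofReal_zero, mul_zero, sub_zero, Complex.log_one, add_zero]
    congr 2
    push_cast
    ring
  rw [hval] at hlim
  refine hlim.congr' ?_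
  filter_upwards [self_mem_nhdsWithin, hz1', hAlim.eventually_gt_atTop 1] with x hx hx1 hx2
  exact (charFun_normalizedOccupation_lattice (three_mul_lt_one hx) a rfl rfl hx2.le θ rfl hx1).symm

end SquareLattice

theorem mainTheorem11 :
    (∀ (n : ℕ), 1 ≤ n → ∀ e : (hypercubicGraph (ZMod n) 2).Edge,
      (∀ x : ℝ≥0, 0 < x → x < 1 / 3 →
        0 < (hypercubicGraph (ZMod n) 2).meanOccupation (fun _ => x) e ∧
        (hypercubicGraph (ZMod n) 2).meanOccupation (fun _ => x) e < ∞) ∧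
      TendstoInDistribution
        (fun x : ℝ≥0 => (hypercubicGraph (ZMod n) 2).normalizedOccupation (fun _ => x) e)
        (𝓝[<] (1 / 3 : ℝ≥0))
        (fun y : ℝ => y ^ 2)
        (fun x : ℝ≥0 => (hypercubicGraph (ZMod n) 2).soupLaw (fun _ => x))
        (gaussianReal 0 1)) ∧
    (∀ e : (hypercubicGraph ℤ 2).Edge,
      (∀ x : ℝ≥0, 0 < x → x < 1 / 3 →
        0 < (hypercubicGraph ℤ 2).meanOccupation (fun _ => x) e ∧
        (hypercubicGraph ℤ 2).meanOccupation (fun _ => x) e < ∞) ∧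
      TendstoInDistribution
        (fun x : ℝ≥0 => (hypercubicGraph ℤ 2).normalizedOccupation (fun _ => x) e)
        (𝓝[<] (1 / 3 : ℝ≥0))
        (fun y : ℝ => y ^ 2)
        (fun x : ℝ≥0 => (hypercubicGraph ℤ 2).soupLaw (fun _ => x))
        (gaussianReal 0 1)) := by
  constructor
  · intro n hn e
    have : NeZero n := ⟨by omega⟩
    obtain ⟨a, rfl⟩ := Quotient.exists_rep e
    exact ⟨fun x hx0 hx => meanOccupation_lattice_pos_and_lt_top a hx0 hx,
      tendstoInDistribution_normalizedOccupation_lattice a⟩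
  · intro e
    obtain ⟨a, rfl⟩ := Quotient.exists_rep e
    exact ⟨fun x hx0 hx => meanOccupation_lattice_pos_and_lt_top a hx0 hx,
      tendstoInDistribution_normalizedOccupation_lattice a⟩
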